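/- Let $M\subseteq B(H)$ be a von Neumann algebra with a faithful normal tracial state $\tau$, and suppose that $M$ is generated, as a von Neumann algebra, by an algebraically free tuple $X=(X_1,\dots,X_n)$ of self-adjoint elements. Let $L^2(M)$ be the completion of $M$ for the inner product $\langle x,y\rangle=\tau(y^*x)$; identify $L^2(M^{op})$ with $L^2(M)$, and let $M\bar\otimes M^{op}$ be the von Neumann algebra generated on $L^2(M)\bar\otimes L^2(M^{op})$ by the operators $x\otimes y\mapsto ax\otimes yb$ $(a,b\in M)$, embedded in $L^2(M)\bar\otimes L^2(M^{op})$ by $T\mapsto T(1\otimes1)$. Let $\partial_i:\mathbb C\langle X_1,\dots,X_n\rangle\to L^2(M)\bar\otimes L^2(M^{op})$ be the free difference quotients, i.e. the derivations with $\partial_iX_j=\delta_{ij}\,1\otimes1$, viewed as densely defined unbounded operators on $L^2(M)$. Assume the Lipschitz conjugate variable condition: each $\partial_i$ is closable, with closure $\bar\partial_i$; the conjugate variables $\xi_i=\partial_i^*(1\otimes1)\in L^2(M)$ exist and belong to $\bigcap_j\mathrm{Dom}(\bar\partial_j)$; and $\bar\partial_j\xi_i\in M\bar\otimes M^{op}$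 for all $i,j$. Let $\bar\partial=(\bar\partial_1,\dots,\bar\partial_n)$ with domain $\mathrm{Dom}(\bar\partial)=\bigcap_i\mathrm{Dom}(\bar\partial_i)$, and let $\Delta=\bar\partial^*\bar\partial$, with its natural domain. Assume moreover the curvature--dimension condition $CD(1,\infty)$: $$\mathscr J\xi:=(\bar\partial_j\xi_i)_{i,j=1}^n\ \ge\ (1\otimes1)\otimes I_n\qquad\text{in the } C^*\text{-algebra } M_n(M\bar\otimes M^{op}).$$ Then $\mathrm{Dom}(\Delta^{1/2})=\mathrm{Dom}(\bar\partial)$ (that is, any positive self-adjoint $S$ with $S^2=\Delta$ has domain $\mathrm{Dom}(\bar\partial)$), and for every $Y\in\mathrm{Dom}(\bar\partial)$ with $\tau(Y):=\langle Y,1\rangle=0$, $$\|Y\|_{L^2(M)}^2\ \le\ \sum_{i=1}^n\|\bar\partial_iY\|^2_{L^2(M)\bar\otimes L^2(M^{op})}.$$ If $f\in\mathrm{Dom}(\bar\partial)$ satisfies $\tau(f)=0$ and $$\|f\|_{L^2(M)}^2=\sum_{i=1}^n\|\bar\partial_if\|^2_{L^2(M)\bar\otimes L^2(M^{op})},$$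 then $f\in\mathrm{Dom}(\Delta)$ and $\Delta f=f$. -/

import Mathlib

open scoped TensorProduct InnerProductSpace LinearPMap Matrix

noncomputable section

namespace FreeProb

universe u

/-! ### Unbounded operators -/

section Unbounded

variable {E F G : Type*} [AddCommGroup E] [Module ℂ E] [AddCommGroup F] [Module ℂ F]
  [AddCommGroup G] [Module ℂ G]

/-- The subspace `{x ∈ Dom f | f x ∈ Dom g}`. -/
def compDomain (g : F →ₗ.[ℂ] G) (f : E →ₗ.[ℂ] F) : Submodule ℂ E :=
  (g.domain.comap f.toFun).map f.domain.subtype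

/-- The composition `g ∘ f` of unbounded operators, on its natural domain
`{x ∈ Dom f | f x ∈ Dom g}`. -/
def compPMap (g : F →ₗ.[ℂ] G) (f : E →ₗ.[ℂ] F) : E →ₗ.[ℂ] G :=
  g.comp (f.domRestrict (compDomain g f)) (by
    rintro ⟨x, hx, hxf⟩
    obtain ⟨y, hy, rfl⟩ := hx
    exact hy)

theorem mem_compPMap_domain {g : F →ₗ.[ℂ] G} {f : E →ₗ.[ℂ] F} {x : E} :
    x ∈ (compPMap g f).domain ↔ ∃ hx : x ∈ f.domain, f ⟨x, hx⟩ ∈ g.domain := by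
  constructor
  · rintro ⟨⟨y, hy, rfl⟩, hxf⟩
    exact ⟨y.2, hy⟩
  · rintro ⟨hx, hg⟩
    exact ⟨⟨⟨x, hx⟩, hg, rfl⟩, hx⟩

theorem compPMap_apply {g : F →ₗ.[ℂ] G} {f : E →ₗ.[ℂ] F} {x : E}
    (hx : x ∈ f.domain) (hg : f ⟨x, hx⟩ ∈ g.domain) :
    compPMap g f ⟨x, mem_compPMap_domain.2 ⟨hx, hg⟩⟩ = g ⟨f ⟨x, hx⟩, hg⟩ := rfl

/-- `S = A^{1/2}`: the operator `S` is self-adjoint and positive, and `S ∘ S = A`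
(with equality of domains). -/
structure IsPositiveSqrt {E : Type*} [NormedAddCommGroup E] [InnerProductSpace ℂ E]
    [CompleteSpace E] (S A : E →ₗ.[ℂ] E) : Prop where
  isSelfAdjoint : IsSelfAdjoint S
  nonneg : ∀ x : S.domain, 0 ≤ (⟪(x : E), S x⟫_ℂ).re
  sq_eq : compPMap S S = A

end Unbounded

/-! ### Generated von Neumann algebras -/

section Generated

variable {K : Type*} [NormedAddCommGroup K] [InnerProductSpace ℂ K] [CompleteSpace K]

/-- The von Neumann algebra `(s ∪ s*)''` generated by a set `s` of bounded operators. -/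
def generatedVN (s : Set (K →L[ℂ] K)) : VonNeumannAlgebra K :=
  VonNeumannAlgebra.commutant
    { toStarSubalgebra := StarSubalgebra.centralizer ℂ s
      centralizer_centralizer' := Set.centralizer_centralizer_centralizer (s ∪ star s) }

theorem coe_generatedVN (s : Set (K →L[ℂ] K)) :
    (generatedVN s : Set (K →L[ℂ] K)) = Set.centralizer (Set.centralizer (s ∪ star s)) := by
  rw [generatedVN, VonNeumannAlgebra.coe_commutant]
  rfl

end Generated

/-! ### The free difference quotients on noncommutative polynomials -/

section FreeDifferenceQuotient

variable {n : ℕ}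

/-- Noncommutative polynomials `ℂ⟨t₁, …, tₙ⟩`. -/
abbrev NCPoly (n : ℕ) : Type := FreeAlgebra ℂ (Fin n)

/-- The homomorphism `p ↦ [[p ⊗ 1, ∂ᵢ p], [0, 1 ⊗ p]]`. -/
def triangularHom (i : Fin n) :
    NCPoly n →ₐ[ℂ] Matrix (Fin 2) (Fin 2) (NCPoly n ⊗[ℂ] NCPoly n) :=
  FreeAlgebra.lift ℂ fun j =>
    !![FreeAlgebra.ι ℂ j ⊗ₜ 1, if i = j then 1 ⊗ₜ 1 else 0; 0, 1 ⊗ₜ FreeAlgebra.ι ℂ j]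

/-- The algebraic free difference quotient
`∂ᵢ : ℂ⟨t₁, …, tₙ⟩ → ℂ⟨t₁, …, tₙ⟩ ⊗ ℂ⟨t₁, …, tₙ⟩`, the derivation with
`∂ᵢ tⱼ = δᵢⱼ 1 ⊗ 1` (see `polyDQ_ι` and `polyDQ_mul`). -/
def polyDQ (i : Fin n) : NCPoly n →ₗ[ℂ] NCPoly n ⊗[ℂ] NCPoly n where
  toFun p := triangularHom i p 0 1
  map_add' p q := by simp
  map_smul' c p := by simp

theorem polyDQ_ι (i j : Fin n) :
    polyDQ i (FreeAlgebra.ι ℂ j) = if i = j then 1 ⊗ₜ[ℂ] 1 else 0 := by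
  simp [polyDQ, triangularHom]

theorem triangularHom_entries (i : Fin n) (p : NCPoly n) :
    triangularHom i p 0 0 = p ⊗ₜ 1 ∧ triangularHom i p 1 0 = 0 ∧
      triangularHom i p 1 1 = 1 ⊗ₜ p := by
  induction p using FreeAlgebra.induction with
  | grade0 r =>
    simp only [AlgHom.commutes, Matrix.algebraMap_matrix_apply]
    refine ⟨by simp [Algebra.TensorProduct.algebraMap_apply], by simp, ?_⟩
    simp [Algebra.algebraMap_eq_smul_one, Algebra.TensorProduct.one_def]
  | grade1 j => simp [triangularHom]
  | mul a b ha hb =>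
    simp [Matrix.mul_apply, Fin.sum_univ_two, ha, hb, Algebra.TensorProduct.tmul_mul_tmul]
  | add a b ha hb =>
    simp [ha, hb, TensorProduct.add_tmul, TensorProduct.tmul_add]

/-- The Leibniz rule `∂ᵢ(pq) = (p ⊗ 1) ∂ᵢ q + ∂ᵢ p (1 ⊗ q)`. -/
theorem polyDQ_mul (i : Fin n) (p q : NCPoly n) :
    polyDQ i (p * q) = (p ⊗ₜ 1) * polyDQ i q + polyDQ i p * (1 ⊗ₜ q) := by
  simp [polyDQ, Matrix.mul_apply, Fin.sum_univ_two, triangularHom_entries]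

end FreeDifferenceQuotient

/-! ### Tracial von Neumann algebras and their `L²` spaces -/

section Tracial

variable {H : Type u} [NormedAddCommGroup H] [InnerProductSpace ℂ H] [CompleteSpace H]

/-- A faithful normal tracial state on a von Neumann algebra `M ⊆ B(H)`. Normality is expressed
as usual by `τ x = ∑ₖ ⟨x ζₖ, ζₖ⟩` for a sequence of vectors `ζₖ ∈ H`, which also gives the
positivity of `τ`. -/
structure TracialState (M : VonNeumannAlgebra H) where
  toLinearMap : M.toStarSubalgebra →ₗ[ℂ] ℂ
  map_one' : toLinearMap 1 = 1
  normal' : ∃ ζ : ℕ → H, ∀ x : M.toStarSubalgebra,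
    HasSum (fun k => ⟪ζ k, (x : H →L[ℂ] H) (ζ k)⟫_ℂ) (toLinearMap x)
  tracial' : ∀ x y, toLinearMap (x * y) = toLinearMap (y * x)
  faithful' : ∀ x, toLinearMap (star x * x) = 0 → x = 0

variable {M : VonNeumannAlgebra H}

instance : CoeFun (TracialState M) (fun _ => M.toStarSubalgebra → ℂ) := ⟨fun τ => τ.toLinearMap⟩

theorem TracialState.map_star (τ : TracialState M) (x : M.toStarSubalgebra) :
    τ (star x) = starRingEnd ℂ (τ x) := by
  obtain ⟨ζ, hζ⟩ := τ.normal'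
  refine (hζ (star x)).unique ?_
  have h := (hζ x).star
  refine h.congr_fun fun k => ?_
  simp [ContinuousLinearMap.star_eq_adjoint, ContinuousLinearMap.adjoint_inner_right]

theorem TracialState.hasSum_norm_sq {τ : TracialState M} {ζ : ℕ → H}
    (hζ : ∀ x : M.toStarSubalgebra,
      HasSum (fun k => ⟪ζ k, (x : H →L[ℂ] H) (ζ k)⟫_ℂ) (τ x)) (x : M.toStarSubalgebra) :
    HasSum (fun k => ‖(x : H →L[ℂ] H) (ζ k)‖ ^ 2) (τ (star x * x)).re := by
  have h := Complex.hasSum_re (hζ (star x * x))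
  refine h.congr_fun fun k => ?_
  simp [ContinuousLinearMap.star_eq_adjoint, ContinuousLinearMap.adjoint_inner_right,
    ← Complex.ofReal_pow]

/-- The algebra `M` regarded as a space with inner product `⟪x, y⟫ = τ(x* y)`. -/
def PreL2 (_ : TracialState M) : Type u := M.toStarSubalgebra

instance (τ : TracialState M) : AddCommGroup (PreL2 τ) :=
  inferInstanceAs (AddCommGroup M.toStarSubalgebra)

instance (τ : TracialState M) : Module ℂ (PreL2 τ) :=
  inferInstanceAs (Module ℂ M.toStarSubalgebra)

/-- The identity map `M → PreL2 τ`. -/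
def toPreL2 (τ : TracialState M) : M.toStarSubalgebra ≃ₗ[ℂ] PreL2 τ :=
  LinearEquiv.refl ℂ M.toStarSubalgebra

/-- The inner product `⟪x, y⟫ = τ(x* y)` on `M` (linear in the second variable, as always
in Mathlib). -/
@[reducible] def innerCore (τ : TracialState M) : InnerProductSpace.Core ℂ (PreL2 τ) where
  inner x y := τ (star ((toPreL2 τ).symm x) * (toPreL2 τ).symm y)
  conj_inner_symm x y := by
    rw [← TracialState.map_star, star_mul, star_star]
  re_inner_nonneg x := by
    obtain ⟨ζ, hζ⟩ := τ.normal'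
    exact (TracialState.hasSum_norm_sq hζ ((toPreL2 τ).symm x)).nonneg fun k => sq_nonneg _
  add_left x y z := by simp [add_mul]
  smul_left x y r := by simp
  definite x hx := by
    have := τ.faithful' _ hx
    simpa using this

instance (τ : TracialState M) : NormedAddCommGroup (PreL2 τ) :=
  (innerCore τ).toNormedAddCommGroup

instance (τ : TracialState M) : InnerProductSpace ℂ (PreL2 τ) :=
  InnerProductSpace.ofCore (innerCore τ).toCore

theorem PreL2.inner_eq (τ : TracialState M) (x y : M.toStarSubalgebra) :
    ⟪toPreL2 τ x, toPreL2 τ y⟫_ℂ = τ (star x * y) := rfl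

theorem PreL2.norm_sq_eq (τ : TracialState M) (x : M.toStarSubalgebra) :
    ‖toPreL2 τ x‖ ^ 2 = (τ (star x * x)).re := by
  rw [← PreL2.inner_eq, inner_self_eq_norm_sq_to_K]
  simp [← Complex.ofReal_pow]

theorem PreL2.norm_mul_left_le (τ : TracialState M) (a x : M.toStarSubalgebra) :
    ‖toPreL2 τ (a * x)‖ ≤ ‖(a : H →L[ℂ] H)‖ * ‖toPreL2 τ x‖ := by
  obtain ⟨ζ, hζ⟩ := τ.normal'
  refine (sq_le_sq₀ (norm_nonneg _) (by positivity)).1 ?_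
  rw [mul_pow, PreL2.norm_sq_eq, PreL2.norm_sq_eq]
  refine hasSum_le (fun k => ?_) (TracialState.hasSum_norm_sq hζ (a * x))
    ((TracialState.hasSum_norm_sq hζ x).mul_left (‖(a : H →L[ℂ] H)‖ ^ 2))
  rw [← mul_pow]
  exact pow_le_pow_left₀ (norm_nonneg _) ((a : H →L[ℂ] H).le_opNorm _) 2

theorem PreL2.norm_star (τ : TracialState M) (x : M.toStarSubalgebra) :
    ‖toPreL2 τ (star x)‖ = ‖toPreL2 τ x‖ := by
  rw [← sq_eq_sq₀ (norm_nonneg _) (norm_nonneg _), PreL2.norm_sq_eq, PreL2.norm_sq_eq,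
    τ.tracial', star_star]

theorem PreL2.norm_mul_right_le (τ : TracialState M) (b x : M.toStarSubalgebra) :
    ‖toPreL2 τ (x * b)‖ ≤ ‖(b : H →L[ℂ] H)‖ * ‖toPreL2 τ x‖ := by
  rw [← PreL2.norm_star, star_mul]
  refine (PreL2.norm_mul_left_le τ _ _).trans (le_of_eq ?_)
  rw [PreL2.norm_star]
  congr 1
  exact _root_.norm_star (b : H →L[ℂ] H)

/-- The Hilbert space `L²(M, τ)`: the completion of `M` for `⟪x, y⟫ = τ(x* y)`. -/
abbrev L2 (τ : TracialState M) : Type u := UniformSpace.Completion (PreL2 τ)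

/-- The canonical embedding `M → L²(M, τ)`. -/
def toL2 (τ : TracialState M) : M.toStarSubalgebra →ₗ[ℂ] L2 τ :=
  (UniformSpace.Completion.toComplL : PreL2 τ →L[ℂ] L2 τ).toLinearMap ∘ₗ
    (toPreL2 τ).toLinearMap

/-- The operator `x ↦ a x` on `L²(M, τ)`, for `a ∈ M`. -/
def leftMul (τ : TracialState M) (a : M.toStarSubalgebra) : L2 τ →L[ℂ] L2 τ :=
  (LinearMap.mkContinuous
    ((toPreL2 τ).toLinearMap ∘ₗ LinearMap.mulLeft ℂ a ∘ₗ (toPreL2 τ).symm.toLinearMap)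
    ‖(a : H →L[ℂ] H)‖
    (fun x => PreL2.norm_mul_left_le τ a ((toPreL2 τ).symm x))).completion

/-- The operator `x ↦ x b` on `L²(M, τ)`, for `b ∈ M`. It is the left multiplication by `b` in
the opposite algebra, acting on `L²(Mᵒᵖ, τ) = L²(M, τ)`. -/
def rightMul (τ : TracialState M) (b : M.toStarSubalgebra) : L2 τ →L[ℂ] L2 τ :=
  (LinearMap.mkContinuous
    ((toPreL2 τ).toLinearMap ∘ₗ LinearMap.mulRight ℂ b ∘ₗ (toPreL2 τ).symm.toLinearMap)
    ‖(b : H →L[ℂ] H)‖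
    (fun x => PreL2.norm_mul_right_le τ b ((toPreL2 τ).symm x))).completion

theorem leftMul_toL2 (τ : TracialState M) (a x : M.toStarSubalgebra) :
    leftMul τ a (toL2 τ x) = toL2 τ (a * x) :=
  ContinuousLinearMap.completion_apply_coe _ _

theorem rightMul_toL2 (τ : TracialState M) (b x : M.toStarSubalgebra) :
    rightMul τ b (toL2 τ x) = toL2 τ (x * b) :=
  ContinuousLinearMap.completion_apply_coe _ _

/-- The Hilbert space tensor product `L²(M) ⊗̄ L²(Mᵒᵖ)`, where `L²(Mᵒᵖ, τ)` is identified with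
`L²(M, τ)`: both are the completion of the same vector space for the same inner product, because
`τ(x* y) = τ(y x*)`. -/
abbrev L2Tensor (τ : TracialState M) : Type u := UniformSpace.Completion (L2 τ ⊗[ℂ] L2 τ)

/-- The canonical map of the algebraic into the Hilbert space tensor product. -/
def toL2Tensor (τ : TracialState M) : L2 τ ⊗[ℂ] L2 τ →ₗ[ℂ] L2Tensor τ :=
  (UniformSpace.Completion.toComplL : _ →L[ℂ] L2Tensor τ).toLinearMap

/-- The vector `1 ⊗ 1`. -/
def oneTensor (τ : TracialState M) : L2Tensor τ := toL2Tensor τ (toL2 τ 1 ⊗ₜ toL2 τ 1)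

/-- The operator `x ⊗ y ↦ a x ⊗ y b`, i.e. the action of `a ⊗ b ∈ M ⊗ Mᵒᵖ` by left
multiplication on each leg of `L²(M) ⊗̄ L²(Mᵒᵖ)`. -/
def elemTensor (τ : TracialState M) (a b : M.toStarSubalgebra) : L2Tensor τ →L[ℂ] L2Tensor τ :=
  (TensorProduct.mapL (leftMul τ a) (rightMul τ b)).completion

theorem elemTensor_apply (τ : TracialState M) (a b x y : M.toStarSubalgebra) :
    elemTensor τ a b (toL2Tensor τ (toL2 τ x ⊗ₜ toL2 τ y)) =
      toL2Tensor τ (toL2 τ (a * x) ⊗ₜ toL2 τ (y * b)) := by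
  rw [← leftMul_toL2, ← rightMul_toL2]
  exact ContinuousLinearMap.completion_apply_coe _ _

/-- The von Neumann tensor product `M ⊗̄ Mᵒᵖ`, acting on `L²(M) ⊗̄ L²(Mᵒᵖ)`. -/
def tensorOp (τ : TracialState M) : VonNeumannAlgebra (L2Tensor τ) :=
  generatedVN (Set.range fun p : M.toStarSubalgebra × M.toStarSubalgebra =>
    elemTensor τ p.1 p.2)

/-! ### Differential calculus of a self-adjoint tuple -/

variable {n : ℕ}

/-- Evaluation `p ↦ p(X)` of noncommutative polynomials. -/
def evalPoly (X : Fin n → M.toStarSubalgebra) : NCPoly n →ₐ[ℂ] M.toStarSubalgebra :=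
  FreeAlgebra.lift ℂ X

/-- The tuple `X` is algebraically free: it satisfies no nontrivial polynomial relation. -/
def AlgebraicallyFree (X : Fin n → M.toStarSubalgebra) : Prop :=
  Function.Injective (evalPoly X)

/-- Evaluation `p ⊗ q ↦ p(X) ⊗ q(X) ∈ L²(M) ⊗̄ L²(Mᵒᵖ)`. -/
def evalTensor (τ : TracialState M) (X : Fin n → M.toStarSubalgebra) :
    NCPoly n ⊗[ℂ] NCPoly n →ₗ[ℂ] L2Tensor τ :=
  toL2Tensor τ ∘ₗ TensorProduct.map (toL2 τ ∘ₗ (evalPoly X).toLinearMap)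
    (toL2 τ ∘ₗ (evalPoly X).toLinearMap)

/-- The free difference quotient `∂ᵢ` as an unbounded operator `L²(M) → L²(M) ⊗̄ L²(Mᵒᵖ)` with
domain `ℂ⟨X₁, …, Xₙ⟩`: its graph is `{(p(X), (∂ᵢ p)(X))}`, which is the graph of an operator
when `X` is algebraically free. -/
def dq (τ : TracialState M) (X : Fin n → M.toStarSubalgebra) (i : Fin n) :
    L2 τ →ₗ.[ℂ] L2Tensor τ :=
  (LinearMap.range ((toL2 τ ∘ₗ (evalPoly X).toLinearMap).prod
    (evalTensor τ X ∘ₗ polyDQ i))).toLinearPMap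

/-- The closure `∂̄ᵢ` (for closable `∂ᵢ`). -/
def dqBar (τ : TracialState M) (X : Fin n → M.toStarSubalgebra) (i : Fin n) :
    L2 τ →ₗ.[ℂ] L2Tensor τ :=
  (dq τ X i).closure

/-- The gradient `∂̄ = (∂̄₁, …, ∂̄ₙ) : L²(M) → (L²(M) ⊗̄ L²(Mᵒᵖ))^{⊕ n}` with domain
`⋂ᵢ Dom(∂̄ᵢ)`. -/
def gradBar (τ : TracialState M) (X : Fin n → M.toStarSubalgebra) :
    L2 τ →ₗ.[ℂ] PiLp 2 (fun _ : Fin n => L2Tensor τ) where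
  domain := ⨅ i, (dqBar τ X i).domain
  toFun := (WithLp.linearEquiv 2 ℂ (Fin n → L2Tensor τ)).symm.toLinearMap ∘ₗ
    LinearMap.pi fun i => (dqBar τ X i).toFun ∘ₗ Submodule.inclusion (iInf_le _ i)

theorem gradBar_apply (τ : TracialState M) (X : Fin n → M.toStarSubalgebra)
    (Y : (gradBar τ X).domain) (i : Fin n) :
    gradBar τ X Y i = dqBar τ X i ⟨Y, iInf_le (fun i => (dqBar τ X i).domain) i Y.2⟩ := rfl

/-- The Laplacian `Δ = ∂* ∂̄`, on `{x ∈ Dom(∂̄) | ∂̄ x ∈ Dom(∂*)}`, where `∂*` is the adjoint of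
the gradient `∂̄`. -/
def laplacian (τ : TracialState M) (X : Fin n → M.toStarSubalgebra) : L2 τ →ₗ.[ℂ] L2 τ :=
  compPMap (gradBar τ X)† (gradBar τ X)

/-- The Dirichlet form `ℰ(Y) = ∑ᵢ ‖∂̄ᵢ Y‖²`. -/
def energy (τ : TracialState M) (X : Fin n → M.toStarSubalgebra) (Y : (gradBar τ X).domain) : ℝ :=
  ∑ i, ‖gradBar τ X Y i‖ ^ 2

/-- The conjugate variable `ξᵢ = ∂ᵢ*(1 ⊗ 1)`, given that `1 ⊗ 1 ∈ Dom(∂ᵢ*)`. -/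
def conjVar (τ : TracialState M) (X : Fin n → M.toStarSubalgebra) (i : Fin n)
    (h : oneTensor τ ∈ ((dq τ X i)†).domain) : L2 τ :=
  (dq τ X i)† ⟨oneTensor τ, h⟩

/-- The Lipschitz conjugate variable condition: the `∂ᵢ` are closable, the conjugate variables
`ξᵢ` exist in `L²(M)` and lie in `Dom(∂̄)`, and each `∂̄ⱼ ξᵢ` lies in
`M ⊗̄ Mᵒᵖ ⊆ L²(M) ⊗̄ L²(Mᵒᵖ)`, where `T ∈ M ⊗̄ Mᵒᵖ` is identified with the vector
`T (1 ⊗ 1)`. -/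
structure LipschitzConjugateVariables (τ : TracialState M) (X : Fin n → M.toStarSubalgebra) :
    Prop where
  closable : ∀ i, (dq τ X i).IsClosable
  exists_conj : ∀ i, oneTensor τ ∈ ((dq τ X i)†).domain
  mem_domain : ∀ i, conjVar τ X i (exists_conj i) ∈ (gradBar τ X).domain
  lipschitz : ∀ i j, ∃ T : (tensorOp τ).toStarSubalgebra,
    (T : L2Tensor τ →L[ℂ] L2Tensor τ) (oneTensor τ) = gradBar τ X ⟨_, mem_domain i⟩ j

/-- The noncommutative Jacobian `𝒥ξ = (∂̄ⱼ ξᵢ)ᵢⱼ ∈ Mₙ(M ⊗̄ Mᵒᵖ)`. -/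
def jacobian {τ : TracialState M} {X : Fin n → M.toStarSubalgebra}
    (h : LipschitzConjugateVariables τ X) :
    Matrix (Fin n) (Fin n) (tensorOp τ).toStarSubalgebra :=
  Matrix.of fun i j => (h.lipschitz i j).choose

theorem jacobian_apply_oneTensor {τ : TracialState M} {X : Fin n → M.toStarSubalgebra}
    (h : LipschitzConjugateVariables τ X) (i j : Fin n) :
    (jacobian h i j : L2Tensor τ →L[ℂ] L2Tensor τ) (oneTensor τ) =
      gradBar τ X ⟨conjVar τ X i (h.exists_conj i), h.mem_domain i⟩ j :=
  (h.lipschitz i j).choose_spec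

/-- The curvature-dimension condition `CD(c, ∞)`: `𝒥ξ ≥ c (1 ⊗ 1) ⊗ Iₙ` in the C*-algebra
`Mₙ(M ⊗̄ Mᵒᵖ)`, i.e. the difference is of the form `Q* Q`. -/
def CurvatureDimension {τ : TracialState M} {X : Fin n → M.toStarSubalgebra}
    (h : LipschitzConjugateVariables τ X) (c : ℝ) : Prop :=
  ∃ Q : Matrix (Fin n) (Fin n) (tensorOp τ).toStarSubalgebra,
    jacobian h - (c : ℂ) • (1 : Matrix (Fin n) (Fin n) (tensorOp τ).toStarSubalgebra) = Qᴴ * Q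

/-- `Y ∈ L²₀(M)`, i.e. `τ(Y) = 0` for the extension of `τ` to `L²(M)`. -/
def Centered (τ : TracialState M) (Y : L2 τ) : Prop := ⟪toL2 τ 1, Y⟫_ℂ = 0

end Tracial

end FreeProb

end

/-! The Poincaré inequality is proved by duality against divergences. For polynomials `pᵢ` put `yᵢ =
∂ᵢ*(pᵢ ⊗ 1)` and let `J` be the Jacobian of the conjugate variables. The Leibniz rule builds `yᵢ`
from `ξᵢ`, and the Gram matrix becomes `⟪yᵢ, yⱼ⟫ = ⟪pⱼ* ⊗ 1, Jⱼᵢ (pᵢ* ⊗ 1)⟫`. Hence `J ≥ 1` says `∑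
‖pᵢ‖² ≤ ‖∑ yᵢ‖²` (`CurvatureDimension.sum_norm_sq_le_norm_sq_sum`). For centered `Y` and `z = c • 1
+ ∑ yᵢ`, Cauchy–Schwarz gives `|⟪z, Y⟫| ≤ ‖z‖ ‖∂̄Y‖` (`norm_inner_le_of_mem_span`); if such `z` are
dense, one may put `z = Y`.

Density (`divergenceOrth_eq_bot`) is the main difficulty. Let `P` be the projection onto the
orthogonal complement of these `z`, and `rₖ = P Xₖ`. The commutator `[Xₖ, P]` has rank at most two
and is expressed through `rₖ` and `1` (`X_mul_orthProj`), so the commutator of `P` with any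
polynomial is a sum of pairings with its difference quotients (`inner_comm_orthProj`). Two special
cases of this formula extend from polynomials to the `ξᵢ`, which `P` kills. They show that `J V`,
for `Vⱼ = 1 ⊗ rⱼ* - rⱼ ⊗ 1`, is orthogonal to all `x ⊗ 1` and `1 ⊗ x`, so `⟪V, J V⟫ = 0`. A second
use of `J ≥ 1` yields `V = 0`, whence `rₖ = 0` (`residue_eq_zero`). Then `P` commutes with every
`Xₖ` and kills `1`, so `P = 0`. The extension to `ξᵢ` needs elementary tensors with one leg merely
in `L²` to lie in `Dom ∂ⱼ*`, which follows from the boundedness of the operators `Jⱼⱼ`.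

The identity of domains holds for every closed densely defined `T`: the domain of `T* T` is a core,
and there `‖S x‖ = ‖T x‖`. In the equality case `f` minimizes a nonnegative quadratic form, and its
Euler–Lagrange equation is the weak form of `Δ f = f`. -/

noncomputable section
namespace FreeProb

/-! ### The operator `T* T` of a closed operator -/

section VonNeumann

variable {E F : Type*} [NormedAddCommGroup E] [InnerProductSpace ℂ E] [CompleteSpace E]
  [NormedAddCommGroup F] [InnerProductSpace ℂ F] [CompleteSpace F]

/-- For a closed densely defined `T`, the operator `1 + T* T` is surjective. -/
theorem exists_add_adjoint_comp_self {T : E →ₗ.[ℂ] F} (hc : T.IsClosed)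
    (hd : Dense (T.domain : Set E)) (h : E) :
    ∃ (x : T.domain) (hx : T x ∈ T†.domain), (x : E) + T† ⟨T x, hx⟩ = h := by
  let e := WithLp.prodContinuousLinearEquiv 2 ℂ E F
  let g : Submodule ℂ (WithLp 2 (E × F)) := T.graph.comap e.toLinearMap
  have hg : IsClosed (g : Set (WithLp 2 (E × F))) := hc.preimage e.continuous
  have : CompleteSpace g := hg.completeSpace_coe
  -- Project `(h, 0)` onto the graph of `T`. Orthogonality of the residue `(h - x, -T x)` to the
  -- graph says exactly that `T* T x = h - x`.
  let w : WithLp 2 (E × F) := e.symm (h, 0)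
  let v := g.starProjection w
  have hv : v ∈ g := g.starProjection_apply_mem w
  have hort : w - v ∈ gᗮ := g.sub_starProjection_mem_orthogonal w
  obtain ⟨x, hx1, hx2⟩ := (T.mem_graph_iff (x := e v)).1 hv
  have key : ∀ y : T.domain, ⟪(y : E), h - x⟫_ℂ = ⟪T y, T x⟫_ℂ := by
    intro y
    have := (Submodule.mem_orthogonal _ _).1 hort (e.symm ((y : E), T y))
      (by change e (e.symm _) ∈ T.graph; rw [e.apply_symm_apply]; exact T.mem_graph y)
    have h1 : (w - v).fst = h - x := by rw [hx1]; rfl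
    have h2 : (w - v).snd = - T x := by
      rw [hx2]; change (0 : F) - _ = _; rw [zero_sub]; rfl
    rw [WithLp.prod_inner_apply, WithLp.ofLp_fst, WithLp.ofLp_snd, WithLp.ofLp_fst,
      WithLp.ofLp_snd, h1, h2, inner_neg_right] at this
    exact add_neg_eq_zero.1 this
  have key' : ∀ y : T.domain, ⟪h - x, (y : E)⟫_ℂ = ⟪T x, T y⟫_ℂ := fun y => by
    rw [← inner_conj_symm, key, inner_conj_symm]
  have hmem : T x ∈ T†.domain := LinearPMap.mem_adjoint_domain_of_exists _ ⟨h - x, key'⟩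
  refine ⟨x, hmem, ?_⟩
  rw [LinearPMap.adjoint_apply_eq hd ⟨T x, hmem⟩ key']
  abel

/-- The domain of `T* T` is a core of the closed densely defined operator `T`. -/
theorem mem_closure_graph_adjoint_comp_self {T : E →ₗ.[ℂ] F} (hc : T.IsClosed)
    (hd : Dense (T.domain : Set E)) (y : T.domain) :
    ((y : E), T y) ∈ closure
      {z : E × F | ∃ x : T.domain, T x ∈ T†.domain ∧ z = ((x : E), T x)} := by
  let e := WithLp.prodContinuousLinearEquiv 2 ℂ E F
  let g₀ : Submodule ℂ E := (compPMap T† T).domain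
  let ι : g₀ →ₗ[ℂ] WithLp 2 (E × F) := e.symm.toLinearMap ∘ₗ
    (g₀.subtype.prod (T.toFun ∘ₗ Submodule.inclusion
      (fun x hx => (mem_compPMap_domain.1 hx).1)))
  let g : Submodule ℂ (WithLp 2 (E × F)) := (LinearMap.range ι).topologicalClosure
  have hgc : IsClosed (g : Set (WithLp 2 (E × F))) := Submodule.isClosed_topologicalClosure _
  have : CompleteSpace g := hgc.completeSpace_coe
  let G : Submodule ℂ (WithLp 2 (E × F)) := T.graph.comap e.toLinearMap
  have hG : IsClosed (G : Set (WithLp 2 (E × F))) := hc.preimage e.continuous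
  have hgG : g ≤ G := by
    refine Submodule.topologicalClosure_minimal _ ?_ hG
    rintro _ ⟨x, rfl⟩
    change e (e.symm _) ∈ T.graph
    rw [e.apply_symm_apply]
    exact T.mem_graph ⟨x, (mem_compPMap_domain.1 x.2).1⟩
  let w : WithLp 2 (E × F) := e.symm ((y : E), T y)
  have hwG : w ∈ G := by change e (e.symm _) ∈ T.graph; rw [e.apply_symm_apply]; exact T.mem_graph y
  let v := g.starProjection w
  have hv : v ∈ g := g.starProjection_apply_mem w
  have hort : w - v ∈ gᗮ := g.sub_starProjection_mem_orthogonal w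
  obtain ⟨z, hz1, hz2⟩ := (T.mem_graph_iff (x := e (w - v))).1 (G.sub_mem hwG (hgG hv))
  -- For `x` in the domain of `T* T`, the graph inner product with `z` is `⟪x + T* T x, z⟫`. Since
  -- `1 + T* T` is onto, `x` can be chosen with `x + T* T x = z`.
  have hz0 : (z : E) = 0 := by
    obtain ⟨x, hx, hxz⟩ := exists_add_adjoint_comp_self hc hd (z : E)
    have hxg : (x : E) ∈ g₀ := mem_compPMap_domain.2 ⟨x.2, hx⟩
    have := (Submodule.mem_orthogonal _ _).1 hort (ι ⟨x, hxg⟩)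
      (Submodule.le_topologicalClosure _ ⟨_, rfl⟩)
    rw [WithLp.prod_inner_apply, WithLp.ofLp_fst, WithLp.ofLp_snd, WithLp.ofLp_fst,
      WithLp.ofLp_snd] at this
    have h1 : (w - v).fst = z := hz1.symm
    have h2 : (w - v).snd = T z := hz2.symm
    rw [h1, h2] at this
    change ⟪(x : E), (z : E)⟫_ℂ + ⟪T x, T z⟫_ℂ = 0 at this
    rw [← LinearPMap.adjoint_isFormalAdjoint hd ⟨T x, hx⟩ z, ← inner_add_left, hxz] at this
    exact inner_self_eq_zero.1 this
  have hwv : w = v := by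
    have hz0' : z = 0 := Subtype.ext hz0
    rw [hz0', T.map_zero] at hz2
    have : e (w - v) = 0 := Prod.ext (by rw [← hz1, hz0]; rfl) (by rw [← hz2]; rfl)
    exact sub_eq_zero.1 (e.map_eq_zero_iff.1 this)
  rw [← hwv] at hv
  have := (e.continuous.continuousOn.image_closure (s := (LinearMap.range ι : Set _)))
  have hmem : e w ∈ e '' closure (LinearMap.range ι : Set (WithLp 2 (E × F))) := ⟨w, hv, rfl⟩
  refine closure_mono ?_ (this hmem)
  rintro _ ⟨_, ⟨x, rfl⟩, rfl⟩
  obtain ⟨hx1, hx2⟩ := mem_compPMap_domain.1 x.2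
  exact ⟨⟨x, hx1⟩, hx2, e.apply_symm_apply _⟩

/-- If `T₁* T₁ ≤ T₂* T₂` (as an inclusion of operators), then `Dom T₁ ≤ Dom T₂`. -/
theorem domain_le_of_adjoint_comp_self_le {F' : Type*} [NormedAddCommGroup F']
    [InnerProductSpace ℂ F'] [CompleteSpace F'] {T₁ : E →ₗ.[ℂ] F} {T₂ : E →ₗ.[ℂ] F'}
    (hc₁ : T₁.IsClosed) (hd₁ : Dense (T₁.domain : Set E))
    (hc₂ : T₂.IsClosed) (hd₂ : Dense (T₂.domain : Set E))
    (h : compPMap T₁† T₁ ≤ compPMap T₂† T₂) : T₁.domain ≤ T₂.domain := by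
  intro y hy
  let D : Submodule ℂ E := (compPMap T₁† T₁).domain
  have hD₁ : ∀ x ∈ D, x ∈ T₁.domain := fun x hx => (mem_compPMap_domain.1 hx).1
  have hD₂ : ∀ x ∈ D, x ∈ T₂.domain := fun x hx => (mem_compPMap_domain.1 (h.1 hx)).1
  -- Both squared norms equal the inner product of `x` with the common value of `T₁* T₁` and `T₂*
  -- T₂`. A sequence from the core converging in the graph norm of `T₁` is therefore Cauchy in that
  -- of `T₂`.
  have hnorm : ∀ x (hx : x ∈ D), ‖T₁ ⟨x, hD₁ x hx⟩‖ = ‖T₂ ⟨x, hD₂ x hx⟩‖ := by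
    intro x hx
    obtain ⟨h1, h1'⟩ := mem_compPMap_domain.1 hx
    obtain ⟨h2, h2'⟩ := mem_compPMap_domain.1 (h.1 hx)
    have e1 := LinearPMap.adjoint_isFormalAdjoint hd₁ ⟨_, h1'⟩ ⟨x, h1⟩
    have e2 := LinearPMap.adjoint_isFormalAdjoint hd₂ ⟨_, h2'⟩ ⟨x, h2⟩
    have e3 := h.2 (x := ⟨x, hx⟩) (y := ⟨x, h.1 hx⟩) rfl
    rw [compPMap_apply h1 h1', compPMap_apply h2 h2'] at e3
    rw [e3, e2] at e1
    have := congrArg Complex.re e1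
    rw [← RCLike.re_eq_complex_re, inner_self_eq_norm_sq,
      inner_self_eq_norm_sq] at this
    exact ((sq_eq_sq₀ (norm_nonneg _) (norm_nonneg _)).1 this).symm
  obtain ⟨u, hu, hlim⟩ := mem_closure_iff_seq_limit.1
    (mem_closure_graph_adjoint_comp_self hc₁ hd₁ ⟨y, hy⟩)
  choose x hx hxu using hu
  have hxD : ∀ k, (x k : E) ∈ D := fun k => mem_compPMap_domain.2 ⟨(x k).2, hx k⟩
  let z : ℕ → T₂.domain := fun k => ⟨x k, hD₂ _ (hxD k)⟩
  have hlim1 : Filter.Tendsto (fun k => (x k : E)) Filter.atTop (nhds y) := by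
    have := (continuous_fst.tendsto _).comp hlim
    refine this.congr fun k => ?_
    simp [hxu]
  have hlim2 : Filter.Tendsto (fun k => T₁ (x k)) Filter.atTop (nhds (T₁ ⟨y, hy⟩)) := by
    have := (continuous_snd.tendsto _).comp hlim
    refine this.congr fun k => ?_
    simp [hxu]
  have hcauchy : CauchySeq fun k => T₂ (z k) := by
    have h1 := hlim2.cauchySeq
    rw [Metric.cauchySeq_iff] at h1 ⊢
    intro ε hε
    obtain ⟨N, hN⟩ := h1 ε hε
    refine ⟨N, fun k hk l hl => ?_⟩
    have := hN k hk l hl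
    rw [dist_eq_norm, ← LinearPMap.map_sub] at this ⊢
    exact (hnorm _ (D.sub_mem (hxD k) (hxD l))).symm.trans_lt this
  obtain ⟨s, hs⟩ := cauchySeq_tendsto_of_complete hcauchy
  have : (y, s) ∈ (T₂.graph : Set (E × F')) :=
    hc₂.mem_of_tendsto (hlim1.prodMk_nhds hs)
      (Filter.Eventually.of_forall fun k => T₂.mem_graph (z k))
  exact LinearPMap.mem_domain_of_mem_graph this

/-- `Dom((T* T)^{1/2}) = Dom T` for a closed densely defined operator `T`. -/
theorem IsPositiveSqrt.domain_eq {T : E →ₗ.[ℂ] F} (hc : T.IsClosed)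
    (hd : Dense (T.domain : Set E)) {S : E →ₗ.[ℂ] E}
    (hS : IsPositiveSqrt S (compPMap T† T)) : S.domain = T.domain := by
  have hSS : S† = S := hS.isSelfAdjoint
  have hdS := hS.isSelfAdjoint.dense_domain
  have hcS : S.IsClosed := hS.isSelfAdjoint.isClosed
  have hsq : compPMap S† S = compPMap T† T := by rw [hSS, hS.sq_eq]
  exact le_antisymm (domain_le_of_adjoint_comp_self_le hcS hdS hc hd hsq.le)
    (domain_le_of_adjoint_comp_self_le hc hd hcS hdS hsq.ge)

end VonNeumann

/-! ### Amplification and the density of a generating algebra -/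

section Amplification

variable {H : Type*} [NormedAddCommGroup H] [InnerProductSpace ℂ H]

theorem norm_apply_le_norm_smul_apply (a : H →L[ℂ] H) (v : lp (fun _ : ℕ => H) 2) (k : ℕ) :
    ‖a (v k)‖ ≤ ‖((‖a‖ : ℂ) • v) k‖ := by
  rw [lp.coeFn_smul, Pi.smul_apply, norm_smul, Complex.norm_real, norm_norm]
  exact a.le_opNorm (v k)

/-- The operator `(vₖ)ₖ ↦ (a vₖ)ₖ` on `ℓ²(ℕ; H)`. -/
def amplification (a : H →L[ℂ] H) :
    lp (fun _ : ℕ => H) 2 →L[ℂ] lp (fun _ : ℕ => H) 2 :=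
  LinearMap.mkContinuous
    { toFun := fun v => ⟨fun k => a (v k), Memℓp.mono' (lp.memℓp ((‖a‖ : ℂ) • v))
        (norm_apply_le_norm_smul_apply a v)⟩
      map_add' := fun v w => by ext k; simp; rfl
      map_smul' := fun c v => by ext k; simp }
    ‖a‖ fun v => by
      have : ‖a‖ * ‖v‖ = ‖(‖a‖ : ℂ) • v‖ := by
        rw [norm_smul, Complex.norm_real, norm_norm]
      rw [this]
      exact lp.norm_mono (by norm_num) (norm_apply_le_norm_smul_apply a v)

@[simp]
theorem amplification_apply (a : H →L[ℂ] H) (v : lp (fun _ : ℕ => H) 2) (k : ℕ) :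
    amplification a v k = a (v k) := rfl

theorem amplification_single (a : H →L[ℂ] H) (k : ℕ) (x : H) :
    amplification a (lp.single 2 k x) = lp.single 2 k (a x) := by
  ext l
  rw [amplification_apply]
  by_cases h : l = k
  · subst h; simp
  · simp [h]

variable [CompleteSpace H]

theorem inner_amplification_left (a : H →L[ℂ] H) (v w : lp (fun _ : ℕ => H) 2) :
    ⟪amplification a v, w⟫_ℂ = ⟪v, amplification (star a) w⟫_ℂ := by
  simp [lp.inner_eq_tsum, ContinuousLinearMap.star_eq_adjoint,
    ContinuousLinearMap.adjoint_inner_right]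

/-- The von Neumann density theorem for the ultrastrong topology: an operator commuting with the
commutant of a unital `*`-algebra `𝒜` can be approximated by `𝒜` on square summable families. -/
theorem amplification_mem_closure (𝒜 : Subalgebra ℂ (H →L[ℂ] H)) (hstar : ∀ a ∈ 𝒜, star a ∈ 𝒜)
    {x : H →L[ℂ] H} (hx : ∀ y : H →L[ℂ] H, (∀ a ∈ 𝒜, a * y = y * a) → y * x = x * y)
    (ζ : lp (fun _ : ℕ => H) 2) :
    amplification x ζ ∈ closure {v | ∃ a ∈ 𝒜, amplification a ζ = v} := by
  let V₀ : Submodule ℂ (lp (fun _ : ℕ => H) 2) :=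
    { carrier := {v | ∃ a ∈ 𝒜, amplification a ζ = v}
      zero_mem' := ⟨0, 𝒜.zero_mem, by ext k; simp⟩
      add_mem' := by
        rintro _ _ ⟨a, ha, rfl⟩ ⟨b, hb, rfl⟩
        exact ⟨a + b, 𝒜.add_mem ha hb, by ext k; simp⟩
      smul_mem' := by
        rintro c _ ⟨a, ha, rfl⟩
        exact ⟨c • a, 𝒜.smul_mem ha c, by ext k; simp⟩ }
  let V := V₀.topologicalClosure
  have hVc : IsClosed (V : Set (lp (fun _ : ℕ => H) 2)) := V₀.isClosed_topologicalClosure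
  have : CompleteSpace V := hVc.completeSpace_coe
  have hinv : ∀ a ∈ 𝒜, ∀ v ∈ V, amplification a v ∈ V := by
    intro a ha v hv
    have hle : V₀ ≤ V.comap (amplification a).toLinearMap := by
      rintro _ ⟨b, hb, rfl⟩
      exact V₀.le_topologicalClosure ⟨a * b, 𝒜.mul_mem ha hb, by ext k; simp⟩
    exact Submodule.topologicalClosure_minimal V₀ hle
      (hVc.preimage (amplification a).continuous) hv
  let P := V.starProjection
  have hcomm : ∀ a ∈ 𝒜, ∀ v, P (amplification a v) = amplification a (P v) := by
    intro a ha v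
    refine Submodule.eq_starProjection_of_mem_of_inner_eq_zero
      (hinv a ha _ (V.starProjection_apply_mem v)) fun w hw => ?_
    rw [← map_sub, inner_amplification_left]
    exact (Submodule.mem_orthogonal' _ _).1 (V.sub_starProjection_mem_orthogonal v) _
      (hinv _ (hstar a ha) w hw)
  let ev (k : ℕ) : lp (fun _ : ℕ => H) 2 →L[ℂ] H := lp.evalCLM ℂ (fun _ : ℕ => H) 2 k
  -- The matrix entries of `P`. Since `P` commutes with the amplified algebra, each entry lies in
  -- the commutant of `𝒜`, hence commutes with `x`; summing over entries, `P` fixes the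
  -- amplification of `x` applied to `ζ`.
  let y (k l : ℕ) : H →L[ℂ] H :=
    ev k ∘L P ∘L lp.singleContinuousLinearMap ℂ (fun _ : ℕ => H) 2 l
  have hy : ∀ k l z, y k l z = P (lp.single 2 l z) k := fun k l z => rfl
  have hyx : ∀ k l, y k l * x = x * y k l := by
    intro k l
    refine hx _ fun a ha => ?_
    ext z
    simp only [mul_apply_eq_comp, hy]
    rw [← amplification_single, hcomm a ha, amplification_apply]
  have hζ : P ζ = ζ := Submodule.starProjection_eq_self_iff.2
    (V₀.le_topologicalClosure ⟨1, 𝒜.one_mem, by ext k; simp⟩)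
  have hsum (v : lp (fun _ : ℕ => H) 2) (k : ℕ) : HasSum (fun l => y k l (v l)) (P v k) :=
    ((lp.hasSum_single (by norm_num) v).mapL P).mapL (ev k)
  have hfix : P (amplification x ζ) = amplification x ζ := by
    ext k
    refine (hsum _ k).unique ?_
    have h1 := (hsum ζ k).mapL x
    rw [hζ] at h1
    refine h1.congr_fun fun l => ?_
    exact congrArg (fun f : H →L[ℂ] H => f (ζ l)) (hyx k l)
  exact Submodule.starProjection_eq_self_iff.1 hfix

end Amplification

/-! ### Density of the polynomials in `L²(M)` -/

section Density

variable {H : Type*} [NormedAddCommGroup H] [InnerProductSpace ℂ H] [CompleteSpace H]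
  {M : VonNeumannAlgebra H} {n : ℕ}

theorem exists_evalPoly_eq_star {X : Fin n → M.toStarSubalgebra} (hX : ∀ i, IsSelfAdjoint (X i))
    (p : NCPoly n) : ∃ q, evalPoly X q = star (evalPoly X p) := by
  induction p using FreeAlgebra.induction with
  | grade0 r => exact ⟨algebraMap ℂ _ (star r), by
      simp only [AlgHom.commutes, algebraMap_star_comm]⟩
  | grade1 j => exact ⟨FreeAlgebra.ι ℂ j, by simp [evalPoly, (hX j).star_eq]⟩
  | mul a b ha hb =>
    obtain ⟨a', ha⟩ := ha
    obtain ⟨b', hb⟩ := hb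
    exact ⟨b' * a', by rw [map_mul, map_mul, star_mul, ha, hb]⟩
  | add a b ha hb =>
    obtain ⟨a', ha⟩ := ha
    obtain ⟨b', hb⟩ := hb
    exact ⟨a' + b', by rw [map_add, map_add, star_add, ha, hb]⟩

/-- Normality supplies vectors `ζₖ` with `∑ ‖m ζₖ‖² = τ(m* m)`, so the `L²` norm of `m` is the `ℓ²`
norm of the family `(m ζₖ)`. That family is square summable already for `m = 1`, and the ultrastrong
density theorem at this single vector is `L²` density. -/
theorem toL2_mem_closure_range (τ : TracialState M) {X : Fin n → M.toStarSubalgebra}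
    (hX : ∀ i, IsSelfAdjoint (X i))
    (hgen : M = generatedVN (Set.range fun i => (X i : H →L[ℂ] H)))
    (x : M.toStarSubalgebra) :
    toL2 τ x ∈ closure (Set.range fun p => toL2 τ (evalPoly X p)) := by
  obtain ⟨ζ, hζ⟩ := τ.normal'
  have hmem : Memℓp ζ 2 := by
    refine memℓp_gen ?_
    have := (TracialState.hasSum_norm_sq hζ 1).summable
    simpa using this
  let z : lp (fun _ : ℕ => H) 2 := ⟨ζ, hmem⟩
  let 𝒜 : Subalgebra ℂ (H →L[ℂ] H) := (M.toStarSubalgebra.subtype.toAlgHom.comp (evalPoly X)).range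
  have hstar : ∀ a ∈ 𝒜, star a ∈ 𝒜 := by
    rintro _ ⟨p, rfl⟩
    obtain ⟨q, hq⟩ := exists_evalPoly_eq_star hX p
    exact ⟨q, congrArg Subtype.val hq⟩
  have hXmem : ∀ i, (X i : H →L[ℂ] H) ∈ 𝒜 := fun i => ⟨FreeAlgebra.ι ℂ i, by
    change ((evalPoly X (FreeAlgebra.ι ℂ i) : M.toStarSubalgebra) : H →L[ℂ] H) = _
    simp [evalPoly]⟩
  have hx : ∀ y : H →L[ℂ] H, (∀ a ∈ 𝒜, a * y = y * a) →
      y * (x : H →L[ℂ] H) = (x : H →L[ℂ] H) * y := by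
    intro y hy
    have hxM := ((congrArg (fun N : VonNeumannAlgebra H => (N : Set (H →L[ℂ] H))) hgen).trans
      (coe_generatedVN _)).le x.2
    refine hxM y ?_
    rintro a (⟨i, rfl⟩ | ha)
    · exact hy _ (hXmem i)
    · obtain ⟨i, hi⟩ := ha
      refine hy _ ?_
      have : a = star (X i : H →L[ℂ] H) := by rw [← star_star a, ← hi]
      rw [this]
      exact hstar _ (hXmem i)
  have hcl := amplification_mem_closure 𝒜 hstar hx z
  rw [Metric.mem_closure_iff] at hcl ⊢
  intro ε hε
  obtain ⟨_, ⟨_, ⟨p, rfl⟩, rfl⟩, hdist⟩ := hcl ε hε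
  refine ⟨_, ⟨p, rfl⟩, ?_⟩
  let m : M.toStarSubalgebra := x - evalPoly X p
  have hnorm : ‖toL2 τ m‖ = ‖amplification (m : H →L[ℂ] H) z‖ := by
    rw [← sq_eq_sq₀ (norm_nonneg _) (norm_nonneg _)]
    have h1 : ‖toL2 τ m‖ = ‖toPreL2 τ m‖ := UniformSpace.Completion.norm_coe _
    rw [h1, PreL2.norm_sq_eq]
    refine (TracialState.hasSum_norm_sq hζ m).unique ?_
    have := lp.hasSum_norm (p := 2) (by norm_num) (amplification (m : H →L[ℂ] H) z)
    simpa using this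
  rw [dist_eq_norm] at hdist ⊢
  rw [← map_sub]
  change ‖toL2 τ m‖ < ε
  rw [hnorm]
  refine lt_of_eq_of_lt (congrArg norm ?_) hdist
  ext k
  simp [m]

theorem denseRange_toL2 (τ : TracialState M) : DenseRange (toL2 τ) :=
  UniformSpace.Completion.denseRange_coe (α := PreL2 τ)

/-- The polynomials in a generating tuple are dense in `L²(M)`. -/
theorem denseRange_toL2_evalPoly (τ : TracialState M) {X : Fin n → M.toStarSubalgebra}
    (hX : ∀ i, IsSelfAdjoint (X i))
    (hgen : M = generatedVN (Set.range fun i => (X i : H →L[ℂ] H))) :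
    DenseRange fun p => toL2 τ (evalPoly X p) := by
  rw [DenseRange, ← dense_closure]
  refine (denseRange_toL2 τ).mono ?_
  rintro _ ⟨x, rfl⟩
  exact toL2_mem_closure_range τ hX hgen x

end Density

/-! ### Calculus in `L²(M)` and `L²(M) ⊗̄ L²(Mᵒᵖ)` -/

section Tensor

variable {H : Type*} [NormedAddCommGroup H] [InnerProductSpace ℂ H] [CompleteSpace H]
  {M : VonNeumannAlgebra H} (τ : TracialState M)

theorem inner_toL2 (x y : M.toStarSubalgebra) : ⟪toL2 τ x, toL2 τ y⟫_ℂ = τ (star x * y) :=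
  UniformSpace.Completion.inner_coe (toPreL2 τ x) (toPreL2 τ y)

theorem inner_one_one : ⟪toL2 τ 1, toL2 τ 1⟫_ℂ = 1 := by
  rw [inner_toL2, star_one, one_mul]
  exact τ.map_one'

theorem norm_one_L2 : ‖toL2 τ 1‖ = 1 := by
  have := inner_self_eq_norm_sq_to_K (𝕜 := ℂ) (toL2 τ 1)
  rw [inner_one_one] at this
  have h : ‖toL2 τ 1‖ ^ 2 = 1 := Complex.ofReal_injective (by
    rw [Complex.ofReal_pow, Complex.ofReal_one]; exact this.symm)
  simpa using (sq_eq_sq₀ (norm_nonneg (toL2 τ 1)) zero_le_one).1 (h.trans (one_pow 2).symm)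

theorem norm_toL2_star (x : M.toStarSubalgebra) : ‖toL2 τ (star x)‖ = ‖toL2 τ x‖ := by
  have h (y : M.toStarSubalgebra) : ‖toL2 τ y‖ = ‖toPreL2 τ y‖ :=
    UniformSpace.Completion.norm_coe _
  rw [h, h, PreL2.norm_star]

theorem toL2_injective : Function.Injective (toL2 τ) := fun _ _ h =>
  (toPreL2 τ).injective (UniformSpace.Completion.coe_injective _ h)

theorem leftMul_one_apply (x : L2 τ) : leftMul τ 1 x = x := by
  induction x using (denseRange_toL2 τ).induction_on with
  | hp => exact isClosed_eq (leftMul τ 1).continuous continuous_id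
  | ih a => rw [leftMul_toL2, one_mul]

theorem rightMul_one_apply (x : L2 τ) : rightMul τ 1 x = x := by
  induction x using (denseRange_toL2 τ).induction_on with
  | hp => exact isClosed_eq (rightMul τ 1).continuous continuous_id
  | ih a => rw [rightMul_toL2, mul_one]

theorem leftMul_mul_apply (a b : M.toStarSubalgebra) (x : L2 τ) :
    leftMul τ (a * b) x = leftMul τ a (leftMul τ b x) := by
  induction x using (denseRange_toL2 τ).induction_on with
  | hp => exact isClosed_eq (by fun_prop) (by fun_prop)
  | ih c => simp only [leftMul_toL2, mul_assoc]

theorem rightMul_mul_apply (a b : M.toStarSubalgebra) (x : L2 τ) :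
    rightMul τ (a * b) x = rightMul τ b (rightMul τ a x) := by
  induction x using (denseRange_toL2 τ).induction_on with
  | hp => exact isClosed_eq (by fun_prop) (by fun_prop)
  | ih c => simp only [rightMul_toL2, mul_assoc]

theorem leftMul_rightMul (a b : M.toStarSubalgebra) (x : L2 τ) :
    leftMul τ a (rightMul τ b x) = rightMul τ b (leftMul τ a x) := by
  induction x using (denseRange_toL2 τ).induction_on with
  | hp => exact isClosed_eq (by fun_prop) (by fun_prop)
  | ih c => simp only [leftMul_toL2, rightMul_toL2, mul_assoc]

theorem inner_leftMul_left (a : M.toStarSubalgebra) (x y : L2 τ) :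
    ⟪leftMul τ a x, y⟫_ℂ = ⟪x, leftMul τ (star a) y⟫_ℂ := by
  induction x, y using (denseRange_toL2 τ).induction_on₂ with
  | hp => exact isClosed_eq (by fun_prop) (by fun_prop)
  | h b c => simp only [leftMul_toL2, inner_toL2, star_mul, mul_assoc]

theorem inner_rightMul_left (a : M.toStarSubalgebra) (x y : L2 τ) :
    ⟪rightMul τ a x, y⟫_ℂ = ⟪x, rightMul τ (star a) y⟫_ℂ := by
  induction x, y using (denseRange_toL2 τ).induction_on₂ with
  | hp => exact isClosed_eq (by fun_prop) (by fun_prop)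
  | h b c =>
    simp only [rightMul_toL2, inner_toL2, star_mul]
    rw [mul_assoc, τ.tracial', mul_assoc]

/-- The continuous bilinear map `(x, y) ↦ x ⊗ y`. -/
def tens : L2 τ →L[ℂ] L2 τ →L[ℂ] L2Tensor τ :=
  (ContinuousLinearMap.compL ℂ (L2 τ) (L2 τ ⊗[ℂ] L2 τ) (L2Tensor τ)
    UniformSpace.Completion.toComplL) ∘L TensorProduct.mkL ℂ (L2 τ) (L2 τ)

theorem oneTensor_eq : oneTensor τ = tens τ (toL2 τ 1) (toL2 τ 1) := rfl

theorem inner_tens (x y x' y' : L2 τ) :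
    ⟪tens τ x y, tens τ x' y'⟫_ℂ = ⟪x, x'⟫_ℂ * ⟪y, y'⟫_ℂ :=
  (UniformSpace.Completion.inner_coe _ _).trans (TensorProduct.inner_tmul _ x x' y y')

theorem norm_tens (x y : L2 τ) : ‖tens τ x y‖ = ‖x‖ * ‖y‖ :=
  (UniformSpace.Completion.norm_coe _).trans (TensorProduct.norm_tmul x y)

/-- Continuous linear maps on the Hilbert space tensor product are determined by the elementary
tensors. -/
theorem tensor_ext {G : Type*} [AddCommGroup G] [Module ℂ G] [TopologicalSpace G] [T2Space G]
    {f g : L2Tensor τ →L[ℂ] G} (h : ∀ x y, f (tens τ x y) = g (tens τ x y)) : f = g := by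
  ext u
  induction u using UniformSpace.Completion.induction_on with
  | hp => exact isClosed_eq f.continuous g.continuous
  | ih u =>
    have : f.toLinearMap ∘ₗ toL2Tensor τ = g.toLinearMap ∘ₗ toL2Tensor τ :=
      TensorProduct.ext' h
    exact LinearMap.congr_fun this u

/-- The operator `f ⊗ g` on the Hilbert space tensor product. -/
def mapTens (f g : L2 τ →L[ℂ] L2 τ) : L2Tensor τ →L[ℂ] L2Tensor τ :=
  (TensorProduct.mapL f g).completion

theorem mapTens_tens (f g : L2 τ →L[ℂ] L2 τ) (x y : L2 τ) :
    mapTens τ f g (tens τ x y) = tens τ (f x) (g y) :=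
  ContinuousLinearMap.completion_apply_coe _ _

theorem elemTensor_tens (a b : M.toStarSubalgebra) (x y : L2 τ) :
    elemTensor τ a b (tens τ x y) = tens τ (leftMul τ a x) (rightMul τ b y) :=
  mapTens_tens τ _ _ x y

theorem inner_tensor_ext {u v : L2Tensor τ} (h : ∀ x y, ⟪tens τ x y, u⟫_ℂ = ⟪tens τ x y, v⟫_ℂ) :
    u = v := by
  have : innerSL ℂ u = innerSL ℂ v := tensor_ext τ fun x y => by
    simp only [innerSL_apply_apply]
    rw [← inner_conj_symm, h, inner_conj_symm]
  refine ext_inner_right ℂ fun w => ?_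
  exact congrArg (fun f : L2Tensor τ →L[ℂ] ℂ => f w) this

theorem inner_mapTens_left {f f' g g' : L2 τ →L[ℂ] L2 τ}
    (hf : ∀ x y, ⟪f x, y⟫_ℂ = ⟪x, f' y⟫_ℂ) (hg : ∀ x y, ⟪g x, y⟫_ℂ = ⟪x, g' y⟫_ℂ)
    (u v : L2Tensor τ) : ⟪mapTens τ f g u, v⟫_ℂ = ⟪u, mapTens τ f' g' v⟫_ℂ := by
  have h1 : ∀ x y v, ⟪tens τ x y, mapTens τ f' g' v⟫_ℂ = ⟪mapTens τ f g (tens τ x y), v⟫_ℂ := by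
    intro x y v
    have : (innerSL ℂ (tens τ x y)) ∘L mapTens τ f' g' = innerSL ℂ (mapTens τ f g (tens τ x y)) :=
      tensor_ext τ fun x' y' => by
        simp only [ContinuousLinearMap.comp_apply, innerSL_apply_apply, mapTens_tens, inner_tens,
          hf, hg]
    exact congrArg (fun f : L2Tensor τ →L[ℂ] ℂ => f v) this
  have h2 : ContinuousLinearMap.adjoint (mapTens τ f g) v = mapTens τ f' g' v :=
    inner_tensor_ext τ fun x y => by rw [ContinuousLinearMap.adjoint_inner_right, h1]
  rw [← h2, ContinuousLinearMap.adjoint_inner_right]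

theorem inner_elemTensor_left (a b : M.toStarSubalgebra) (u v : L2Tensor τ) :
    ⟪elemTensor τ a b u, v⟫_ℂ = ⟪u, elemTensor τ (star a) (star b) v⟫_ℂ :=
  inner_mapTens_left τ (inner_leftMul_left τ a) (inner_rightMul_left τ b) u v

/-- The operator `x ⊗ y ↦ x a ⊗ b y`, i.e. the right multiplication by `a ⊗ b ∈ M ⊗ Mᵒᵖ`. -/
def outerMul (a b : M.toStarSubalgebra) : L2Tensor τ →L[ℂ] L2Tensor τ :=
  mapTens τ (rightMul τ a) (leftMul τ b)

theorem outerMul_tens (a b : M.toStarSubalgebra) (x y : L2 τ) :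
    outerMul τ a b (tens τ x y) = tens τ (rightMul τ a x) (leftMul τ b y) :=
  mapTens_tens τ _ _ x y

theorem inner_outerMul_left (a b : M.toStarSubalgebra) (u v : L2Tensor τ) :
    ⟪outerMul τ a b u, v⟫_ℂ = ⟪u, outerMul τ (star a) (star b) v⟫_ℂ :=
  inner_mapTens_left τ (inner_rightMul_left τ a) (inner_leftMul_left τ b) u v

theorem elemTensor_mul_outerMul (a b c d : M.toStarSubalgebra) :
    elemTensor τ a b * outerMul τ c d = outerMul τ c d * elemTensor τ a b :=
  tensor_ext τ fun x y => by
    simp only [mul_apply_eq_comp, elemTensor_tens, outerMul_tens, leftMul_rightMul]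

theorem star_elemTensor (a b : M.toStarSubalgebra) :
    star (elemTensor τ a b) = elemTensor τ (star a) (star b) := by
  refine ContinuousLinearMap.ext fun v => ext_inner_left ℂ fun u => ?_
  rw [ContinuousLinearMap.star_eq_adjoint, ContinuousLinearMap.adjoint_inner_right,
    inner_elemTensor_left]

/-- The elements of `M ⊗̄ Mᵒᵖ` commute with the right multiplications. -/
theorem tensorOp_outerMul (T : (tensorOp τ).toStarSubalgebra) (a b : M.toStarSubalgebra)
    (u : L2Tensor τ) :
    (T : L2Tensor τ →L[ℂ] L2Tensor τ) (outerMul τ a b u) =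
      outerMul τ a b ((T : L2Tensor τ →L[ℂ] L2Tensor τ) u) := by
  have hT := (coe_generatedVN (Set.range fun p : M.toStarSubalgebra × M.toStarSubalgebra =>
    elemTensor τ p.1 p.2)).le T.2
  have := hT (outerMul τ a b) (by
    rintro f (⟨⟨c, d⟩, rfl⟩ | ⟨⟨c, d⟩, hcd⟩)
    · exact elemTensor_mul_outerMul τ c d a b
    · rw [← star_star f, ← hcd, star_elemTensor]
      exact elemTensor_mul_outerMul τ _ _ a b)
  exact (congrArg (fun f : L2Tensor τ →L[ℂ] L2Tensor τ => f u) this).symm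

/-- The involution `x ↦ x*` on `L²(M)`. -/
def starL2 : L2 τ → L2 τ :=
  UniformSpace.Completion.map fun x : PreL2 τ => toPreL2 τ (star ((toPreL2 τ).symm x))

theorem isometry_star_preL2 :
    Isometry fun x : PreL2 τ => toPreL2 τ (star ((toPreL2 τ).symm x)) :=
  Isometry.of_dist_eq fun x y => by
    rw [dist_eq_norm, dist_eq_norm, ← map_sub, ← star_sub, ← map_sub, PreL2.norm_star,
      LinearEquiv.apply_symm_apply]

theorem continuous_starL2 : Continuous (starL2 τ) := UniformSpace.Completion.continuous_map

theorem starL2_toL2 (a : M.toStarSubalgebra) : starL2 τ (toL2 τ a) = toL2 τ (star a) :=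
  UniformSpace.Completion.map_coe (isometry_star_preL2 τ).uniformContinuous _

theorem inner_starL2_left (x y : L2 τ) : ⟪starL2 τ x, y⟫_ℂ = ⟪starL2 τ y, x⟫_ℂ := by
  have := continuous_starL2 τ
  induction x, y using (denseRange_toL2 τ).induction_on₂ with
  | hp => exact isClosed_eq (by fun_prop) (by fun_prop)
  | h b c => rw [starL2_toL2, starL2_toL2, inner_toL2, inner_toL2, star_star, star_star,
      τ.tracial']

end Tensor

/-! ### Induction principles for noncommutative polynomials -/

section Induction

variable {n : ℕ} {P : NCPoly n → Prop}

/-- Most arguments below can absorb only one variable at a time, not a general product.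
Strengthening the claim to `P q → P (p * q)` makes the product case of the free algebra a
composition. -/
theorem NCPoly.induction_left (hone : P 1) (hadd : ∀ p q, P p → P q → P (p + q))
    (hsmul : ∀ (c : ℂ) p, P p → P (c • p)) (X_mul : ∀ k p, P p → P (FreeAlgebra.ι ℂ k * p))
    (p : NCPoly n) : P p := by
  suffices h : ∀ q, P q → P (p * q) by simpa using h 1 hone
  induction p using FreeAlgebra.induction with
  | grade0 r => intro q hq; rw [← Algebra.smul_def]; exact hsmul r q hq
  | grade1 k => exact X_mul k
  | mul a b ha hb => intro q hq; rw [mul_assoc]; exact ha _ (hb _ hq)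
  | add a b ha hb => intro q hq; rw [add_mul]; exact hadd _ _ (ha _ hq) (hb _ hq)

theorem NCPoly.induction_right (hone : P 1) (hadd : ∀ p q, P p → P q → P (p + q))
    (hsmul : ∀ (c : ℂ) p, P p → P (c • p)) (mul_X : ∀ k p, P p → P (p * FreeAlgebra.ι ℂ k))
    (p : NCPoly n) : P p := by
  suffices h : ∀ q, P q → P (q * p) by simpa using h 1 hone
  induction p using FreeAlgebra.induction with
  | grade0 r => intro q hq; rw [← Algebra.commutes, ← Algebra.smul_def]; exact hsmul r q hq
  | grade1 k => exact mul_X k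
  | mul a b ha hb => intro q hq; rw [← mul_assoc]; exact hb _ (ha _ hq)
  | add a b ha hb => intro q hq; rw [mul_add]; exact hadd _ _ (ha _ hq) (hb _ hq)

end Induction

/-! ### The free difference quotients on polynomials and their adjoints -/

section Polynomial

variable {H : Type*} [NormedAddCommGroup H] [InnerProductSpace ℂ H] [CompleteSpace H]
  {M : VonNeumannAlgebra H} (τ : TracialState M) {n : ℕ} (X : Fin n → M.toStarSubalgebra)

/-- The vector `p(X) ∈ L²(M)`. -/
def polyL2 : NCPoly n →ₗ[ℂ] L2 τ := toL2 τ ∘ₗ (evalPoly X).toLinearMap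

/-- The vector `(∂ᵢ p)(X) ∈ L²(M) ⊗̄ L²(Mᵒᵖ)`. -/
def polyDer (i : Fin n) : NCPoly n →ₗ[ℂ] L2Tensor τ := evalTensor τ X ∘ₗ polyDQ i

theorem polyL2_apply (p : NCPoly n) : polyL2 τ X p = toL2 τ (evalPoly X p) := rfl

theorem polyL2_one : polyL2 τ X 1 = toL2 τ 1 := by rw [polyL2_apply, map_one]

theorem evalPoly_ι (k : Fin n) : evalPoly X (FreeAlgebra.ι ℂ k) = X k := by simp [evalPoly]

theorem polyL2_mul (p q : NCPoly n) :
    polyL2 τ X (p * q) = leftMul τ (evalPoly X p) (polyL2 τ X q) := by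
  rw [polyL2_apply, polyL2_apply, leftMul_toL2, map_mul]

theorem polyL2_mul' (p q : NCPoly n) :
    polyL2 τ X (p * q) = rightMul τ (evalPoly X q) (polyL2 τ X p) := by
  rw [polyL2_apply, polyL2_apply, rightMul_toL2, map_mul]

theorem evalTensor_tmul (p q : NCPoly n) :
    evalTensor τ X (p ⊗ₜ q) = tens τ (polyL2 τ X p) (polyL2 τ X q) := rfl

theorem evalTensor_tmul_one_mul (p : NCPoly n) (u : NCPoly n ⊗[ℂ] NCPoly n) :
    evalTensor τ X ((p ⊗ₜ 1) * u) = elemTensor τ (evalPoly X p) 1 (evalTensor τ X u) := by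
  induction u using TensorProduct.induction_on with
  | zero => simp
  | tmul a b =>
    rw [Algebra.TensorProduct.tmul_mul_tmul, one_mul, evalTensor_tmul, evalTensor_tmul,
      elemTensor_tens, polyL2_mul, rightMul_one_apply]
  | add a b ha hb => rw [mul_add, map_add, map_add, map_add, ha, hb]

theorem evalTensor_mul_one_tmul (p : NCPoly n) (u : NCPoly n ⊗[ℂ] NCPoly n) :
    evalTensor τ X (u * (1 ⊗ₜ p)) = elemTensor τ 1 (evalPoly X p) (evalTensor τ X u) := by
  induction u using TensorProduct.induction_on with
  | zero => simp
  | tmul a b =>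
    rw [Algebra.TensorProduct.tmul_mul_tmul, mul_one, evalTensor_tmul, evalTensor_tmul,
      elemTensor_tens, polyL2_mul', leftMul_one_apply]
  | add a b ha hb => rw [add_mul, map_add, map_add, map_add, ha, hb]

theorem polyDer_mul (i : Fin n) (p q : NCPoly n) :
    polyDer τ X i (p * q) = elemTensor τ (evalPoly X p) 1 (polyDer τ X i q) +
      elemTensor τ 1 (evalPoly X q) (polyDer τ X i p) := by
  simp only [polyDer, LinearMap.comp_apply, polyDQ_mul, map_add, evalTensor_tmul_one_mul,
    evalTensor_mul_one_tmul]

theorem polyDer_ι (i k : Fin n) :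
    polyDer τ X i (FreeAlgebra.ι ℂ k) = if i = k then oneTensor τ else 0 := by
  simp only [polyDer, LinearMap.comp_apply, polyDQ_ι]
  split_ifs
  · rw [evalTensor_tmul, polyL2_one, oneTensor_eq]
  · exact map_zero _

theorem polyDer_algebraMap (i : Fin n) (r : ℂ) : polyDer τ X i (algebraMap ℂ _ r) = 0 := by
  have : polyDQ i (algebraMap ℂ (NCPoly n) r) = 0 := by
    change triangularHom i (algebraMap ℂ _ r) 0 1 = 0
    rw [AlgHom.commutes, Matrix.algebraMap_matrix_apply]
    simp
  simp only [polyDer, LinearMap.comp_apply, this, map_zero]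

theorem polyDer_one (i : Fin n) : polyDer τ X i 1 = 0 := by
  simpa using polyDer_algebraMap τ X i 1

theorem polyDer_X_mul (i k : Fin n) (p : NCPoly n) :
    polyDer τ X i (FreeAlgebra.ι ℂ k * p) = elemTensor τ (X k) 1 (polyDer τ X i p) +
      if i = k then tens τ (toL2 τ 1) (polyL2 τ X p) else 0 := by
  rw [polyDer_mul, evalPoly_ι, polyDer_ι]
  split_ifs
  · rw [oneTensor_eq, elemTensor_tens, leftMul_one_apply, rightMul_toL2, one_mul, polyL2_apply]
  · rw [map_zero]

theorem polyDer_mul_X (i k : Fin n) (p : NCPoly n) :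
    polyDer τ X i (p * FreeAlgebra.ι ℂ k) = elemTensor τ 1 (X k) (polyDer τ X i p) +
      if i = k then tens τ (polyL2 τ X p) (toL2 τ 1) else 0 := by
  rw [polyDer_mul, evalPoly_ι, polyDer_ι, add_comm]
  split_ifs
  · rw [oneTensor_eq, elemTensor_tens, rightMul_one_apply, leftMul_toL2, mul_one, polyL2_apply]
  · rw [map_zero]

/-- `u ∈ Dom(∂ᵢ*)` with `∂ᵢ* u = y`. -/
def HasAdjoint (i : Fin n) (u : L2Tensor τ) (y : L2 τ) : Prop :=
  ∀ p, ⟪u, polyDer τ X i p⟫_ℂ = ⟪y, polyL2 τ X p⟫_ℂ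

variable {τ X} {i : Fin n} {u v : L2Tensor τ} {y z : L2 τ}

theorem HasAdjoint.add (h : HasAdjoint τ X i u y) (h' : HasAdjoint τ X i v z) :
    HasAdjoint τ X i (u + v) (y + z) := fun p => by
  rw [inner_add_left, inner_add_left, h p, h' p]

theorem HasAdjoint.sub (h : HasAdjoint τ X i u y) (h' : HasAdjoint τ X i v z) :
    HasAdjoint τ X i (u - v) (y - z) := fun p => by
  rw [inner_sub_left, inner_sub_left, h p, h' p]

theorem HasAdjoint.smul (h : HasAdjoint τ X i u y) (c : ℂ) :
    HasAdjoint τ X i (c • u) (c • y) := fun p => by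
  rw [inner_smul_left, inner_smul_left, h p]

theorem HasAdjoint.inner_one_left (h : HasAdjoint τ X i u y) : ⟪toL2 τ 1, y⟫_ℂ = 0 := by
  rw [← inner_conj_symm, ← polyL2_one τ X, ← h 1, polyDer_one, inner_zero_right, map_zero]

/-- The slice `x ⊗ y ↦ τ(x) y`. -/
def sliceLeft (τ : TracialState M) : L2Tensor τ →L[ℂ] L2 τ :=
  ContinuousLinearMap.adjoint (tens τ (toL2 τ 1))

/-- The slice `x ⊗ y ↦ τ(y) x`. -/
def sliceRight (τ : TracialState M) : L2Tensor τ →L[ℂ] L2 τ :=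
  ContinuousLinearMap.adjoint ((tens τ).flip (toL2 τ 1))

theorem inner_sliceLeft (u : L2Tensor τ) (x : L2 τ) :
    ⟪sliceLeft τ u, x⟫_ℂ = ⟪u, tens τ (toL2 τ 1) x⟫_ℂ :=
  ContinuousLinearMap.adjoint_inner_left _ _ _

theorem inner_sliceRight (u : L2Tensor τ) (x : L2 τ) :
    ⟪sliceRight τ u, x⟫_ℂ = ⟪u, tens τ x (toL2 τ 1)⟫_ℂ :=
  ContinuousLinearMap.adjoint_inner_left _ _ _

/-- The Leibniz rule, dualized: as `Xₖ` is self-adjoint, pairing `(Xₖ ⊗ 1) u` with `∂ᵢ p` is pairing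
`u` with `∂ᵢ(Xₖ p)`, up to the term `δᵢₖ 1 ⊗ p`, which produces the slice. This generates elements
of `Dom ∂ᵢ*` from known ones. -/
theorem HasAdjoint.X_mul (hX : ∀ i, IsSelfAdjoint (X i)) (h : HasAdjoint τ X i u y) (k : Fin n) :
    HasAdjoint τ X i (elemTensor τ (X k) 1 u)
      (leftMul τ (X k) y - if i = k then sliceLeft τ u else 0) := fun p => by
  have h1 := h (FreeAlgebra.ι ℂ k * p)
  rw [polyDer_X_mul, polyL2_mul, evalPoly_ι, inner_add_right] at h1
  rw [inner_elemTensor_left, inner_sub_left, inner_leftMul_left, star_one, (hX k).star_eq, ← h1]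
  split_ifs
  · rw [inner_sliceLeft, add_sub_cancel_right]
  · rw [inner_zero_right, inner_zero_left, add_sub_cancel_right]

theorem HasAdjoint.mul_X (hX : ∀ i, IsSelfAdjoint (X i)) (h : HasAdjoint τ X i u y) (k : Fin n) :
    HasAdjoint τ X i (elemTensor τ 1 (X k) u)
      (rightMul τ (X k) y - if i = k then sliceRight τ u else 0) := fun p => by
  have h1 := h (p * FreeAlgebra.ι ℂ k)
  rw [polyDer_mul_X, polyL2_mul', evalPoly_ι, inner_add_right] at h1
  rw [inner_elemTensor_left, inner_sub_left, inner_rightMul_left, star_one, (hX k).star_eq, ← h1]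
  split_ifs
  · rw [inner_sliceRight, add_sub_cancel_right]
  · rw [inner_zero_right, inner_zero_left, add_sub_cancel_right]

theorem sliceLeft_tens (x y : L2 τ) : sliceLeft τ (tens τ x y) = ⟪toL2 τ 1, x⟫_ℂ • y :=
  ext_inner_right ℂ fun z => by
    rw [inner_sliceLeft, inner_tens, inner_smul_left, inner_conj_symm]

theorem sliceRight_tens (x y : L2 τ) : sliceRight τ (tens τ x y) = ⟪toL2 τ 1, y⟫_ℂ • x :=
  ext_inner_right ℂ fun z => by
    rw [inner_sliceRight, inner_tens, inner_smul_left, inner_conj_symm, mul_comm]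

/-! ### The closed free difference quotients -/

/-- Freeness makes the relation single-valued: `p(X) = 0` in `L²(M)` forces `p = 0`, because `τ` is
faithful and evaluation is injective. -/
theorem dq_graph (hfree : AlgebraicallyFree X) (i : Fin n) :
    (dq τ X i).graph = LinearMap.range ((polyL2 τ X).prod (polyDer τ X i)) := by
  refine Submodule.toLinearPMap_graph_eq _ ?_
  rintro ⟨x, w⟩ ⟨p, hp⟩ (hx : x = 0)
  obtain ⟨h1, h2⟩ := Prod.ext_iff.1 hp
  change toL2 τ (evalPoly X p) = x at h1
  change polyDer τ X i p = w at h2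
  have h3 : p = 0 := hfree (toL2_injective τ (by rw [h1, hx, map_zero, map_zero]))
  change w = 0
  rw [← h2, h3, map_zero]

theorem dqBar_graph (hfree : AlgebraicallyFree X) (hcl : (dq τ X i).IsClosable) :
    ((dqBar τ X i).graph : Set (L2 τ × L2Tensor τ)) =
      closure (Set.range fun p => (polyL2 τ X p, polyDer τ X i p)) := by
  rw [dqBar, ← hcl.graph_closure_eq_closure_graph, dq_graph hfree]
  rfl

theorem polyL2_mem_graph (hfree : AlgebraicallyFree X) (hcl : (dq τ X i).IsClosable)
    (p : NCPoly n) : (polyL2 τ X p, polyDer τ X i p) ∈ (dqBar τ X i).graph := by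
  rw [← SetLike.mem_coe, dqBar_graph hfree hcl]
  exact subset_closure ⟨p, rfl⟩

theorem one_mem_graph (hfree : AlgebraicallyFree X) (hcl : (dq τ X i).IsClosable) :
    (toL2 τ 1, (0 : L2Tensor τ)) ∈ (dqBar τ X i).graph := by
  have := polyL2_mem_graph hfree hcl 1
  rwa [polyL2_one, polyDer_one] at this

theorem isClosed_dqBar_graph (hfree : AlgebraicallyFree X) (hcl : (dq τ X i).IsClosable) :
    IsClosed ((dqBar τ X i).graph : Set (L2 τ × L2Tensor τ)) := by
  rw [dqBar_graph hfree hcl]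
  exact isClosed_closure

theorem dqBar_graph_induction (hfree : AlgebraicallyFree X) (hcl : (dq τ X i).IsClosable)
    {P : L2 τ × L2Tensor τ → Prop} (hP : IsClosed {z | P z})
    (h : ∀ p, P (polyL2 τ X p, polyDer τ X i p)) {z : L2 τ × L2Tensor τ}
    (hz : z ∈ (dqBar τ X i).graph) : P z := by
  rw [← SetLike.mem_coe, dqBar_graph hfree hcl] at hz
  refine closure_minimal (t := {z | P z}) ?_ hP hz
  rintro _ ⟨p, rfl⟩
  exact h p

theorem HasAdjoint.inner_graph (h : HasAdjoint τ X i u y) (hfree : AlgebraicallyFree X)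
    (hcl : (dq τ X i).IsClosable) {x : L2 τ} {w : L2Tensor τ}
    (hx : (x, w) ∈ (dqBar τ X i).graph) : ⟪u, w⟫_ℂ = ⟪y, x⟫_ℂ :=
  dqBar_graph_induction hfree hcl (P := fun z => ⟪u, z.2⟫_ℂ = ⟪y, z.1⟫_ℂ)
    (isClosed_eq (by fun_prop) (by fun_prop)) h hx

/-- Multiplication by `Xₖ` is bounded on both Hilbert spaces, so the Leibniz rule for a single
variable survives closure of the graph. -/
theorem X_mul_mem_graph (hfree : AlgebraicallyFree X) (hcl : (dq τ X i).IsClosable) (k : Fin n)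
    {x : L2 τ} {w : L2Tensor τ} (hx : (x, w) ∈ (dqBar τ X i).graph) :
    (leftMul τ (X k) x, elemTensor τ (X k) 1 w + if i = k then tens τ (toL2 τ 1) x else 0) ∈
      (dqBar τ X i).graph := by
  refine dqBar_graph_induction hfree hcl (P := fun z => (leftMul τ (X k) z.1,
    elemTensor τ (X k) 1 z.2 + if i = k then tens τ (toL2 τ 1) z.1 else 0) ∈
      (dqBar τ X i).graph) ?_ (fun p => ?_) hx
  · refine (isClosed_dqBar_graph hfree hcl).preimage ?_
    split_ifs <;> fun_prop
  · have := polyL2_mem_graph hfree hcl (i := i) (FreeAlgebra.ι ℂ k * p)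
    rwa [polyDer_X_mul, polyL2_mul, evalPoly_ι] at this

theorem mul_X_mem_graph (hfree : AlgebraicallyFree X) (hcl : (dq τ X i).IsClosable) (k : Fin n)
    {x : L2 τ} {w : L2Tensor τ} (hx : (x, w) ∈ (dqBar τ X i).graph) :
    (rightMul τ (X k) x, elemTensor τ 1 (X k) w + if i = k then tens τ x (toL2 τ 1) else 0) ∈
      (dqBar τ X i).graph := by
  refine dqBar_graph_induction hfree hcl (P := fun z => (rightMul τ (X k) z.1,
    elemTensor τ 1 (X k) z.2 + if i = k then tens τ z.1 (toL2 τ 1) else 0) ∈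
      (dqBar τ X i).graph) ?_ (fun p => ?_) hx
  · refine (isClosed_dqBar_graph hfree hcl).preimage ?_
    split_ifs <;> fun_prop
  · have := polyL2_mem_graph hfree hcl (i := i) (p * FreeAlgebra.ι ℂ k)
    rwa [polyDer_mul_X, polyL2_mul', evalPoly_ι] at this

end Polynomial

/-! ### Linearity of the multiplication operators; conjugate variables and `CD(1, ∞)` -/

section Conjugate

variable {H : Type*} [NormedAddCommGroup H] [InnerProductSpace ℂ H] [CompleteSpace H]
  {M : VonNeumannAlgebra H} {τ : TracialState M} {n : ℕ} {X : Fin n → M.toStarSubalgebra}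

theorem leftMul_add_apply (a b : M.toStarSubalgebra) (x : L2 τ) :
    leftMul τ (a + b) x = leftMul τ a x + leftMul τ b x := by
  induction x using (denseRange_toL2 τ).induction_on with
  | hp => exact isClosed_eq (by fun_prop) (by fun_prop)
  | ih c => simp only [leftMul_toL2, add_mul, map_add]

theorem leftMul_smul_apply (r : ℂ) (a : M.toStarSubalgebra) (x : L2 τ) :
    leftMul τ (r • a) x = r • leftMul τ a x := by
  induction x using (denseRange_toL2 τ).induction_on with
  | hp =>
    exact isClosed_eq (leftMul τ (r • a)).continuous
      ((leftMul τ a).continuous.const_smul r)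
  | ih c => simp only [leftMul_toL2, smul_mul_assoc, map_smul]

theorem rightMul_add_apply (a b : M.toStarSubalgebra) (x : L2 τ) :
    rightMul τ (a + b) x = rightMul τ a x + rightMul τ b x := by
  induction x using (denseRange_toL2 τ).induction_on with
  | hp => exact isClosed_eq (by fun_prop) (by fun_prop)
  | ih c => simp only [rightMul_toL2, mul_add, map_add]

theorem rightMul_smul_apply (r : ℂ) (a : M.toStarSubalgebra) (x : L2 τ) :
    rightMul τ (r • a) x = r • rightMul τ a x := by
  induction x using (denseRange_toL2 τ).induction_on with
  | hp =>
    exact isClosed_eq (rightMul τ (r • a)).continuous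
      ((rightMul τ a).continuous.const_smul r)
  | ih c => simp only [rightMul_toL2, mul_smul_comm, map_smul]

theorem elemTensor_one_one (u : L2Tensor τ) : elemTensor τ 1 1 u = u := by
  have : elemTensor τ 1 1 = 1 := tensor_ext τ fun x y => by
    rw [elemTensor_tens, leftMul_one_apply, rightMul_one_apply]; rfl
  rw [this]; rfl

theorem elemTensor_add_left (a b : M.toStarSubalgebra) (u : L2Tensor τ) :
    elemTensor τ (a + b) 1 u = elemTensor τ a 1 u + elemTensor τ b 1 u := by
  have : elemTensor τ (a + b) 1 = elemTensor τ a 1 + elemTensor τ b 1 := tensor_ext τ fun x y => by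
    simp only [add_apply, elemTensor_tens, leftMul_add_apply, map_add]
  rw [this]; rfl

theorem elemTensor_smul_left (r : ℂ) (a : M.toStarSubalgebra) (u : L2Tensor τ) :
    elemTensor τ (r • a) 1 u = r • elemTensor τ a 1 u := by
  have : elemTensor τ (r • a) 1 = r • elemTensor τ a 1 := tensor_ext τ fun x y => by
    simp only [smul_apply, elemTensor_tens, leftMul_smul_apply, map_smul]
  rw [this]; rfl

theorem elemTensor_add_right (a b : M.toStarSubalgebra) (u : L2Tensor τ) :
    elemTensor τ 1 (a + b) u = elemTensor τ 1 a u + elemTensor τ 1 b u := by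
  have : elemTensor τ 1 (a + b) = elemTensor τ 1 a + elemTensor τ 1 b := tensor_ext τ fun x y => by
    simp only [add_apply, elemTensor_tens, rightMul_add_apply, map_add]
  rw [this]; rfl

theorem elemTensor_smul_right (r : ℂ) (a : M.toStarSubalgebra) (u : L2Tensor τ) :
    elemTensor τ 1 (r • a) u = r • elemTensor τ 1 a u := by
  have : elemTensor τ 1 (r • a) = r • elemTensor τ 1 a := tensor_ext τ fun x y => by
    simp only [smul_apply, elemTensor_tens, rightMul_smul_apply, map_smul]
  rw [this]; rfl

theorem elemTensor_mul_left (a b : M.toStarSubalgebra) (u : L2Tensor τ) :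
    elemTensor τ (a * b) 1 u = elemTensor τ a 1 (elemTensor τ b 1 u) := by
  have : elemTensor τ (a * b) 1 = elemTensor τ a 1 ∘L elemTensor τ b 1 :=
    tensor_ext τ fun x y => by
      simp only [ContinuousLinearMap.comp_apply, elemTensor_tens, leftMul_mul_apply,
        rightMul_one_apply]
  rw [this]; rfl

theorem elemTensor_mul_right (a b : M.toStarSubalgebra) (u : L2Tensor τ) :
    elemTensor τ 1 (a * b) u = elemTensor τ 1 b (elemTensor τ 1 a u) := by
  have : elemTensor τ 1 (a * b) = elemTensor τ 1 b ∘L elemTensor τ 1 a :=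
    tensor_ext τ fun x y => by
      simp only [ContinuousLinearMap.comp_apply, elemTensor_tens, rightMul_mul_apply,
        leftMul_one_apply]
  rw [this]; rfl

/-! ### Vectors in the domain of the adjoints -/

theorem dense_dq_domain (hfree : AlgebraicallyFree X) (hd : DenseRange (polyL2 τ X)) (i : Fin n) :
    Dense ((dq τ X i).domain : Set (L2 τ)) := by
  refine hd.mono ?_
  rintro _ ⟨p, rfl⟩
  refine LinearPMap.mem_domain_of_mem_graph (y := polyDer τ X i p) ?_
  rw [dq_graph hfree]
  exact ⟨p, rfl⟩

theorem exists_polyL2_eq (hfree : AlgebraicallyFree X) (i : Fin n) (x : (dq τ X i).domain) :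
    ∃ p, polyL2 τ X p = x ∧ polyDer τ X i p = dq τ X i x := by
  have := (dq τ X i).mem_graph x
  rw [dq_graph hfree] at this
  obtain ⟨p, hp⟩ := this
  exact ⟨p, Prod.ext_iff.1 hp⟩

theorem hasAdjoint_of_mem (hfree : AlgebraicallyFree X) (hd : DenseRange (polyL2 τ X)) (i : Fin n)
    {u : L2Tensor τ} (hu : u ∈ ((dq τ X i)†).domain) :
    HasAdjoint τ X i u ((dq τ X i)† ⟨u, hu⟩) := by
  intro p
  have hp : (polyL2 τ X p, polyDer τ X i p) ∈ (dq τ X i).graph := by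
    rw [dq_graph hfree]; exact ⟨p, rfl⟩
  obtain ⟨x, hx1, hx2⟩ := ((dq τ X i).mem_graph_iff).1 hp
  have := LinearPMap.adjoint_isFormalAdjoint (dense_dq_domain hfree hd i) ⟨u, hu⟩ x
  change (x : L2 τ) = polyL2 τ X p at hx1
  change dq τ X i x = polyDer τ X i p at hx2
  rw [hx1, hx2] at this
  exact this.symm

theorem exists_hasAdjoint_of_bound (hfree : AlgebraicallyFree X) (hd : DenseRange (polyL2 τ X))
    (i : Fin n) {u : L2Tensor τ} (C : ℝ)
    (hu : ∀ p, ‖⟪u, polyDer τ X i p⟫_ℂ‖ ≤ C * ‖polyL2 τ X p‖) : ∃ y, HasAdjoint τ X i u y := by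
  have hmem : u ∈ ((dq τ X i)†).domain := by
    rw [LinearPMap.mem_adjoint_domain_iff]
    refine AddMonoidHomClass.continuous_of_bound _ C fun x => ?_
    obtain ⟨p, hp1, hp2⟩ := exists_polyL2_eq hfree i x
    have := hu p
    rw [hp1, hp2] at this
    exact this
  exact ⟨_, hasAdjoint_of_mem hfree hd i hmem⟩

theorem HasAdjoint.unique (hd : DenseRange (polyL2 τ X)) {i : Fin n} {u : L2Tensor τ} {y z : L2 τ}
    (hy : HasAdjoint τ X i u y) (hz : HasAdjoint τ X i u z) : y = z :=
  Dense.eq_of_inner_left ℂ hd (by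
    rintro _ ⟨p, rfl⟩
    rw [← hy p, hz p])

theorem hasAdjoint_oneTensor (hfree : AlgebraicallyFree X) (hd : DenseRange (polyL2 τ X))
    (h : LipschitzConjugateVariables τ X) (i : Fin n) :
    HasAdjoint τ X i (oneTensor τ) (conjVar τ X i (h.exists_conj i)) :=
  hasAdjoint_of_mem hfree hd i (h.exists_conj i)

theorem conjVar_mem_graph (h : LipschitzConjugateVariables τ X) (i j : Fin n) :
    (conjVar τ X j (h.exists_conj j),
      (jacobian h j i : L2Tensor τ →L[ℂ] L2Tensor τ) (oneTensor τ)) ∈ (dqBar τ X i).graph := by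
  rw [jacobian_apply_oneTensor, gradBar_apply]
  exact (dqBar τ X i).mem_graph ⟨conjVar τ X j (h.exists_conj j), _⟩

-- Building `y = ∂ⱼ*(p ⊗ 1)` from `ξⱼ` one variable at a time only multiplies by `Xₖ` and subtracts
-- scalars. The scalars have zero derivative, and the extra Leibniz term `1 ⊗ y` is invisible to `a
-- ⊗ 1` because a vector in the range of `∂ⱼ*` is centered. So, tested against `a ⊗ 1`, `∂̄ᵢ y` is
-- just `(p ⊗ 1) ∂̄ᵢ ξⱼ`; such test vectors suffice for the Gram matrix of the divergences.
set_option maxHeartbeats 800000 in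
theorem exists_hasAdjoint_poly_tens_one (hX : ∀ i, IsSelfAdjoint (X i))
    (hfree : AlgebraicallyFree X) (hd : DenseRange (polyL2 τ X))
    (h : LipschitzConjugateVariables τ X) (j : Fin n) (p : NCPoly n) :
    ∃ y, HasAdjoint τ X j (tens τ (polyL2 τ X p) (toL2 τ 1)) y ∧
      ∀ i, ∃ w, (y, w) ∈ (dqBar τ X i).graph ∧ ∀ a, ⟪tens τ a (toL2 τ 1), w⟫_ℂ =
        ⟪tens τ a (toL2 τ 1), elemTensor τ (evalPoly X p) 1
          ((jacobian h j i : L2Tensor τ →L[ℂ] L2Tensor τ) (oneTensor τ))⟫_ℂ := by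
  induction p using NCPoly.induction_left with
  | hone =>
    refine ⟨conjVar τ X j (h.exists_conj j), ?_, fun i => ⟨_, conjVar_mem_graph h i j, ?_⟩⟩
    · rw [polyL2_one]; exact hasAdjoint_oneTensor hfree hd h j
    · intro a; rw [map_one (evalPoly X), elemTensor_one_one]
  | hadd p q hp hq =>
    obtain ⟨y, hy, hyw⟩ := hp
    obtain ⟨z, hz, hzw⟩ := hq
    refine ⟨y + z, ?_, fun i => ?_⟩
    · have := hy.add hz
      rwa [← add_apply, ← map_add, ← map_add] at this
    · obtain ⟨w, hw, hwa⟩ := hyw i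
      obtain ⟨w', hw', hwa'⟩ := hzw i
      refine ⟨w + w', (dqBar τ X i).graph.add_mem hw hw', fun a => ?_⟩
      rw [map_add, elemTensor_add_left, inner_add_right, inner_add_right, hwa, hwa']
  | hsmul c p hp =>
    obtain ⟨y, hy, hyw⟩ := hp
    refine ⟨c • y, ?_, fun i => ?_⟩
    · have := hy.smul c
      rwa [← smul_apply, ← map_smul, ← map_smul] at this
    · obtain ⟨w, hw, hwa⟩ := hyw i
      refine ⟨c • w, (dqBar τ X i).graph.smul_mem c hw, fun a => ?_⟩
      rw [map_smul, elemTensor_smul_left, inner_smul_right, inner_smul_right, hwa]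
  | X_mul k p hp =>
    obtain ⟨y, hy, hyw⟩ := hp
    have hy1 : ⟪toL2 τ 1, y⟫_ℂ = 0 := hy.inner_one_left
    have hp : leftMul τ (X k) (polyL2 τ X p) = polyL2 τ X (FreeAlgebra.ι ℂ k * p) := by
      rw [polyL2_mul, evalPoly_ι]
    have hy' := hy.X_mul hX k
    rw [elemTensor_tens, rightMul_one_apply, sliceLeft_tens, hp] at hy'
    refine ⟨_, hy', fun i => ?_⟩
    obtain ⟨w, hw, hwa⟩ := hyw i
    have h1 := X_mul_mem_graph hfree (h.closable i) k hw
    have h2 : ((if j = k then ⟪toL2 τ 1, polyL2 τ X p⟫_ℂ • toL2 τ 1 else 0 : L2 τ),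
        (0 : L2Tensor τ)) ∈ (dqBar τ X i).graph := by
      split_ifs
      · have := (dqBar τ X i).graph.smul_mem ⟪toL2 τ 1, polyL2 τ X p⟫_ℂ
          (one_mem_graph hfree (h.closable i))
        rwa [Prod.smul_mk, smul_zero] at this
      · exact (dqBar τ X i).graph.zero_mem
    have h4 := (dqBar τ X i).graph.sub_mem h1 h2
    rw [Prod.mk_sub_mk, sub_zero] at h4
    refine ⟨_, h4, fun a => ?_⟩
    have h3 : ⟪tens τ a (toL2 τ 1), if i = k then tens τ (toL2 τ 1) y else 0⟫_ℂ = 0 := by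
      split_ifs
      · rw [inner_tens, hy1, mul_zero]
      · exact inner_zero_right _
    have h5 (v : L2Tensor τ) : ⟪tens τ a (toL2 τ 1), elemTensor τ (X k) 1 v⟫_ℂ =
        ⟪tens τ (leftMul τ (X k) a) (toL2 τ 1), v⟫_ℂ := by
      have := inner_elemTensor_left τ (X k) 1 (tens τ a (toL2 τ 1)) v
      rw [star_one, (hX k).star_eq, elemTensor_tens, rightMul_one_apply] at this
      exact this.symm
    rw [inner_add_right, h3, add_zero, map_mul, elemTensor_mul_left, evalPoly_ι, h5, h5]
    exact hwa _

-- Mirror image, with variables peeled off on the right and test vectors `1 ⊗ a`.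
set_option maxHeartbeats 800000 in
theorem exists_hasAdjoint_one_tens_poly (hX : ∀ i, IsSelfAdjoint (X i))
    (hfree : AlgebraicallyFree X) (hd : DenseRange (polyL2 τ X))
    (h : LipschitzConjugateVariables τ X) (j : Fin n) (p : NCPoly n) :
    ∃ y, HasAdjoint τ X j (tens τ (toL2 τ 1) (polyL2 τ X p)) y ∧
      ∀ i, ∃ w, (y, w) ∈ (dqBar τ X i).graph ∧ ∀ a, ⟪tens τ (toL2 τ 1) a, w⟫_ℂ =
        ⟪tens τ (toL2 τ 1) a, elemTensor τ 1 (evalPoly X p)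
          ((jacobian h j i : L2Tensor τ →L[ℂ] L2Tensor τ) (oneTensor τ))⟫_ℂ := by
  induction p using NCPoly.induction_right with
  | hone =>
    refine ⟨conjVar τ X j (h.exists_conj j), ?_, fun i => ⟨_, conjVar_mem_graph h i j, ?_⟩⟩
    · rw [polyL2_one]; exact hasAdjoint_oneTensor hfree hd h j
    · intro a; rw [map_one (evalPoly X), elemTensor_one_one]
  | hadd p q hp hq =>
    obtain ⟨y, hy, hyw⟩ := hp
    obtain ⟨z, hz, hzw⟩ := hq
    refine ⟨y + z, ?_, fun i => ?_⟩
    · have := hy.add hz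
      rwa [← map_add, ← map_add] at this
    · obtain ⟨w, hw, hwa⟩ := hyw i
      obtain ⟨w', hw', hwa'⟩ := hzw i
      refine ⟨w + w', (dqBar τ X i).graph.add_mem hw hw', fun a => ?_⟩
      rw [map_add, elemTensor_add_right, inner_add_right, inner_add_right, hwa, hwa']
  | hsmul c p hp =>
    obtain ⟨y, hy, hyw⟩ := hp
    refine ⟨c • y, ?_, fun i => ?_⟩
    · have := hy.smul c
      rwa [← map_smul, ← map_smul] at this
    · obtain ⟨w, hw, hwa⟩ := hyw i
      refine ⟨c • w, (dqBar τ X i).graph.smul_mem c hw, fun a => ?_⟩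
      rw [map_smul, elemTensor_smul_right, inner_smul_right, inner_smul_right, hwa]
  | mul_X k p hp =>
    obtain ⟨y, hy, hyw⟩ := hp
    have hy1 : ⟪toL2 τ 1, y⟫_ℂ = 0 := hy.inner_one_left
    have hp : rightMul τ (X k) (polyL2 τ X p) = polyL2 τ X (p * FreeAlgebra.ι ℂ k) := by
      rw [polyL2_mul', evalPoly_ι]
    have hy' := hy.mul_X hX k
    rw [elemTensor_tens, leftMul_one_apply, sliceRight_tens, hp] at hy'
    refine ⟨_, hy', fun i => ?_⟩
    obtain ⟨w, hw, hwa⟩ := hyw i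
    have h1 := mul_X_mem_graph hfree (h.closable i) k hw
    have h2 : ((if j = k then ⟪toL2 τ 1, polyL2 τ X p⟫_ℂ • toL2 τ 1 else 0 : L2 τ),
        (0 : L2Tensor τ)) ∈ (dqBar τ X i).graph := by
      split_ifs
      · have := (dqBar τ X i).graph.smul_mem ⟪toL2 τ 1, polyL2 τ X p⟫_ℂ
          (one_mem_graph hfree (h.closable i))
        rwa [Prod.smul_mk, smul_zero] at this
      · exact (dqBar τ X i).graph.zero_mem
    have h4 := (dqBar τ X i).graph.sub_mem h1 h2
    rw [Prod.mk_sub_mk, sub_zero] at h4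
    refine ⟨_, h4, fun a => ?_⟩
    have h3 : ⟪tens τ (toL2 τ 1) a, if i = k then tens τ y (toL2 τ 1) else 0⟫_ℂ = 0 := by
      split_ifs
      · rw [inner_tens, hy1, zero_mul]
      · exact inner_zero_right _
    have h5 (v : L2Tensor τ) : ⟪tens τ (toL2 τ 1) a, elemTensor τ 1 (X k) v⟫_ℂ =
        ⟪tens τ (toL2 τ 1) (rightMul τ (X k) a), v⟫_ℂ := by
      have := inner_elemTensor_left τ 1 (X k) (tens τ (toL2 τ 1) a) v
      rw [star_one, (hX k).star_eq, elemTensor_tens, leftMul_one_apply] at this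
      exact this.symm
    rw [inner_add_right, h3, add_zero, map_mul, elemTensor_mul_right, evalPoly_ι, h5, h5]
    exact hwa _

/-- Moving `b` to the left gives `b* a ⊗ 1`, a right multiple of `b* ⊗ 1`; right multiplication by
`a` commutes with `T` up to taking adjoints. This turns the vector `T (1 ⊗ 1)`, which is how the
Jacobian is given, into a sesquilinear form of the operator `T`, where its norm and positivity can
be used. -/
theorem inner_tens_one_elemTensor (T : (tensorOp τ).toStarSubalgebra) (a b : M.toStarSubalgebra) :
    ⟪tens τ (toL2 τ a) (toL2 τ 1), elemTensor τ b 1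
      ((T : L2Tensor τ →L[ℂ] L2Tensor τ) (oneTensor τ))⟫_ℂ =
    ⟪tens τ (toL2 τ (star b)) (toL2 τ 1), (T : L2Tensor τ →L[ℂ] L2Tensor τ)
      (tens τ (toL2 τ (star a)) (toL2 τ 1))⟫_ℂ := by
  have h1 : tens τ (toL2 τ (star b * a)) (toL2 τ 1) =
      outerMul τ a 1 (tens τ (toL2 τ (star b)) (toL2 τ 1)) := by
    rw [outerMul_tens, rightMul_toL2, leftMul_one_apply]
  have h2 : tens τ (toL2 τ (star a)) (toL2 τ 1) = outerMul τ (star a) (star 1) (oneTensor τ) := by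
    rw [oneTensor_eq, outerMul_tens, rightMul_toL2, star_one, leftMul_one_apply, one_mul]
  rw [h2, tensorOp_outerMul, ← inner_outerMul_left, ← h1, ← star_star b,
    ← star_one M.toStarSubalgebra, ← inner_elemTensor_left, elemTensor_tens, leftMul_toL2,
    star_one, rightMul_one_apply, star_star]

theorem inner_one_tens_elemTensor (T : (tensorOp τ).toStarSubalgebra) (a b : M.toStarSubalgebra) :
    ⟪tens τ (toL2 τ 1) (toL2 τ a), elemTensor τ 1 b
      ((T : L2Tensor τ →L[ℂ] L2Tensor τ) (oneTensor τ))⟫_ℂ =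
    ⟪tens τ (toL2 τ 1) (toL2 τ (star b)), (T : L2Tensor τ →L[ℂ] L2Tensor τ)
      (tens τ (toL2 τ 1) (toL2 τ (star a)))⟫_ℂ := by
  have h1 : tens τ (toL2 τ 1) (toL2 τ (a * star b)) =
      outerMul τ 1 a (tens τ (toL2 τ 1) (toL2 τ (star b))) := by
    rw [outerMul_tens, leftMul_toL2, rightMul_one_apply]
  have h2 : tens τ (toL2 τ 1) (toL2 τ (star a)) = outerMul τ (star 1) (star a) (oneTensor τ) := by
    rw [oneTensor_eq, outerMul_tens, leftMul_toL2, star_one, rightMul_one_apply, mul_one]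
  rw [h2, tensorOp_outerMul, ← inner_outerMul_left, ← h1, ← star_star b,
    ← star_one M.toStarSubalgebra, ← inner_elemTensor_left, elemTensor_tens, rightMul_toL2,
    star_one, leftMul_one_apply, star_star]

/-- Here `‖y‖² = ⟪p ⊗ 1, ∂̄ⱼ y⟫ = ⟪p* ⊗ 1, Jⱼⱼ (p* ⊗ 1)⟫`. Boundedness of `Jⱼⱼ` makes `p ↦ ∂ⱼ*(p ⊗
1)` continuous in the `L²` norm of `p`, so that it extends to `L²(M)`. -/
theorem norm_sq_le_of_hasAdjoint_tens_one (hX : ∀ i, IsSelfAdjoint (X i))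
    (hfree : AlgebraicallyFree X) (hd : DenseRange (polyL2 τ X))
    (h : LipschitzConjugateVariables τ X) {j : Fin n} {p : NCPoly n} {y : L2 τ}
    (hy : HasAdjoint τ X j (tens τ (polyL2 τ X p) (toL2 τ 1)) y) :
    ‖y‖ ^ 2 ≤ ‖(jacobian h j j : L2Tensor τ →L[ℂ] L2Tensor τ)‖ * ‖polyL2 τ X p‖ ^ 2 := by
  obtain ⟨z, hz, hzw⟩ := exists_hasAdjoint_poly_tens_one hX hfree hd h j p
  obtain rfl := hy.unique hd hz
  obtain ⟨w, hw, hwa⟩ := hzw j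
  have h1 := hy.inner_graph hfree (h.closable j) hw
  rw [hwa, polyL2_apply, inner_tens_one_elemTensor] at h1
  have h2 := congrArg norm h1
  rw [inner_self_eq_norm_sq_to_K, norm_pow, RCLike.norm_ofReal, abs_norm] at h2
  rw [← h2]
  refine (norm_inner_le_norm _ _).trans ?_
  refine (mul_le_mul_of_nonneg_left (ContinuousLinearMap.le_opNorm _ _) (norm_nonneg _)).trans ?_
  rw [norm_tens, norm_toL2_star, norm_one_L2, polyL2_apply]
  apply le_of_eq
  ring

theorem norm_sq_le_of_hasAdjoint_one_tens (hX : ∀ i, IsSelfAdjoint (X i))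
    (hfree : AlgebraicallyFree X) (hd : DenseRange (polyL2 τ X))
    (h : LipschitzConjugateVariables τ X) {j : Fin n} {p : NCPoly n} {y : L2 τ}
    (hy : HasAdjoint τ X j (tens τ (toL2 τ 1) (polyL2 τ X p)) y) :
    ‖y‖ ^ 2 ≤ ‖(jacobian h j j : L2Tensor τ →L[ℂ] L2Tensor τ)‖ * ‖polyL2 τ X p‖ ^ 2 := by
  obtain ⟨z, hz, hzw⟩ := exists_hasAdjoint_one_tens_poly hX hfree hd h j p
  obtain rfl := hy.unique hd hz
  obtain ⟨w, hw, hwa⟩ := hzw j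
  have h1 := hy.inner_graph hfree (h.closable j) hw
  rw [hwa, polyL2_apply, inner_one_tens_elemTensor] at h1
  have h2 := congrArg norm h1
  rw [inner_self_eq_norm_sq_to_K, norm_pow, RCLike.norm_ofReal, abs_norm] at h2
  rw [← h2]
  refine (norm_inner_le_norm _ _).trans ?_
  refine (mul_le_mul_of_nonneg_left (ContinuousLinearMap.le_opNorm _ _) (norm_nonneg _)).trans ?_
  rw [norm_tens, norm_toL2_star, norm_one_L2, polyL2_apply]
  apply le_of_eq
  ring

/-- `a ⊗ 1 ∈ Dom(∂ⱼ*)` for every `a ∈ L²(M)`. -/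
theorem exists_hasAdjoint_tens_one (hX : ∀ i, IsSelfAdjoint (X i))
    (hfree : AlgebraicallyFree X) (hd : DenseRange (polyL2 τ X))
    (h : LipschitzConjugateVariables τ X) (j : Fin n) (a : L2 τ) :
    ∃ y, HasAdjoint τ X j (tens τ a (toL2 τ 1)) y := by
  set c := ‖(jacobian h j j : L2Tensor τ →L[ℂ] L2Tensor τ)‖
  -- The factor `√c` is the square root of the quadratic bound above. For a fixed test polynomial
  -- `q` the inequality is a closed condition on `a`, so polynomial `a` suffice.
  refine exists_hasAdjoint_of_bound hfree hd j (√c * ‖a‖) fun q => ?_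
  induction a using hd.induction_on with
  | hp => exact isClosed_le (by fun_prop) (by fun_prop)
  | ih p =>
    obtain ⟨y, hy, -⟩ := exists_hasAdjoint_poly_tens_one hX hfree hd h j p
    rw [hy q]
    refine (norm_inner_le_norm _ _).trans (mul_le_mul_of_nonneg_right ?_ (norm_nonneg _))
    rw [← sq_le_sq₀ (norm_nonneg _) (by positivity), mul_pow, Real.sq_sqrt (norm_nonneg _)]
    exact norm_sq_le_of_hasAdjoint_tens_one hX hfree hd h hy

/-- `1 ⊗ a ∈ Dom(∂ⱼ*)` for every `a ∈ L²(M)`. -/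
theorem exists_hasAdjoint_one_tens (hX : ∀ i, IsSelfAdjoint (X i))
    (hfree : AlgebraicallyFree X) (hd : DenseRange (polyL2 τ X))
    (h : LipschitzConjugateVariables τ X) (j : Fin n) (a : L2 τ) :
    ∃ y, HasAdjoint τ X j (tens τ (toL2 τ 1) a) y := by
  set c := ‖(jacobian h j j : L2Tensor τ →L[ℂ] L2Tensor τ)‖
  refine exists_hasAdjoint_of_bound hfree hd j (√c * ‖a‖) fun q => ?_
  induction a using hd.induction_on with
  | hp => exact isClosed_le (by fun_prop) (by fun_prop)
  | ih p =>
    obtain ⟨y, hy, -⟩ := exists_hasAdjoint_one_tens_poly hX hfree hd h j p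
    rw [hy q]
    refine (norm_inner_le_norm _ _).trans (mul_le_mul_of_nonneg_right ?_ (norm_nonneg _))
    rw [← sq_le_sq₀ (norm_nonneg _) (by positivity), mul_pow, Real.sq_sqrt (norm_nonneg _)]
    exact norm_sq_le_of_hasAdjoint_one_tens hX hfree hd h hy

/-- `a ⊗ p ∈ Dom(∂ⱼ*)` for `a ∈ L²(M)` and polynomials `p`. -/
theorem exists_hasAdjoint_tens_poly (hX : ∀ i, IsSelfAdjoint (X i))
    (hfree : AlgebraicallyFree X) (hd : DenseRange (polyL2 τ X))
    (h : LipschitzConjugateVariables τ X) (j : Fin n) (a : L2 τ) (p : NCPoly n) :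
    ∃ y, HasAdjoint τ X j (tens τ a (polyL2 τ X p)) y := by
  induction p using NCPoly.induction_right with
  | hone => rw [polyL2_one]; exact exists_hasAdjoint_tens_one hX hfree hd h j a
  | hadd p q hp hq =>
    obtain ⟨y, hy⟩ := hp
    obtain ⟨z, hz⟩ := hq
    exact ⟨y + z, by rw [map_add, map_add]; exact hy.add hz⟩
  | hsmul c p hp =>
    obtain ⟨y, hy⟩ := hp
    exact ⟨c • y, by rw [map_smul, map_smul]; exact hy.smul c⟩
  | mul_X k p hp =>
    obtain ⟨y, hy⟩ := hp
    have := hy.mul_X hX k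
    rw [elemTensor_tens, leftMul_one_apply, ← evalPoly_ι X k, ← polyL2_mul'] at this
    exact ⟨_, this⟩

/-- `p ⊗ a ∈ Dom(∂ⱼ*)` for `a ∈ L²(M)` and polynomials `p`. -/
theorem exists_hasAdjoint_poly_tens (hX : ∀ i, IsSelfAdjoint (X i))
    (hfree : AlgebraicallyFree X) (hd : DenseRange (polyL2 τ X))
    (h : LipschitzConjugateVariables τ X) (j : Fin n) (a : L2 τ) (p : NCPoly n) :
    ∃ y, HasAdjoint τ X j (tens τ (polyL2 τ X p) a) y := by
  induction p using NCPoly.induction_left with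
  | hone => rw [polyL2_one]; exact exists_hasAdjoint_one_tens hX hfree hd h j a
  | hadd p q hp hq =>
    obtain ⟨y, hy⟩ := hp
    obtain ⟨z, hz⟩ := hq
    exact ⟨y + z, by rw [map_add, map_add]; exact hy.add hz⟩
  | hsmul c p hp =>
    obtain ⟨y, hy⟩ := hp
    exact ⟨c • y, by rw [map_smul, map_smul]; exact hy.smul c⟩
  | X_mul k p hp =>
    obtain ⟨y, hy⟩ := hp
    have := hy.X_mul hX k
    rw [elemTensor_tens, rightMul_one_apply, ← evalPoly_ι X k, ← polyL2_mul] at this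
    exact ⟨_, this⟩

/-! ### The curvature-dimension condition -/

/-- Writing the Jacobian as `1 + Q* Q` gives `⟪V, J V⟫ = ‖V‖² + ‖Q V‖²`. This form of the curvature
bound is used twice: for the lower bound on divergences and for the vanishing of the residues. -/
theorem CurvatureDimension.sum_norm_sq_le {h : LipschitzConjugateVariables τ X}
    (hCD : CurvatureDimension h 1) (V : Fin n → L2Tensor τ) :
    ∑ i, ‖V i‖ ^ 2 ≤
      (∑ i, ∑ j, ⟪V i, (jacobian h i j : L2Tensor τ →L[ℂ] L2Tensor τ) (V j)⟫_ℂ).re := by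
  obtain ⟨Q, hQ⟩ := hCD
  have hentry : ∀ i j, (jacobian h i j : L2Tensor τ →L[ℂ] L2Tensor τ) (V j) =
      (if i = j then V j else 0) + ∑ k, star (Q k i : L2Tensor τ →L[ℂ] L2Tensor τ)
        ((Q k j : L2Tensor τ →L[ℂ] L2Tensor τ) (V j)) := by
    intro i j
    have h1 := congrFun (congrFun hQ i) j
    rw [Matrix.sub_apply, Matrix.smul_apply, Complex.ofReal_one, one_smul, sub_eq_iff_eq_add',
      Matrix.mul_apply] at h1
    have h2 := congrArg (fun T : (tensorOp τ).toStarSubalgebra =>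
      (T : L2Tensor τ →L[ℂ] L2Tensor τ) (V j)) h1
    simp only [Matrix.conjTranspose_apply] at h2
    rw [h2]
    rw [AddMemClass.coe_add, add_apply, AddSubmonoidClass.coe_finsetSum,
      sum_apply]
    congr 1
    rw [Matrix.one_apply]
    split_ifs <;> rfl
  have hsum : ∑ i, ∑ j, ⟪V i, (jacobian h i j : L2Tensor τ →L[ℂ] L2Tensor τ) (V j)⟫_ℂ =
      ∑ i, ⟪V i, V i⟫_ℂ + ∑ k, ⟪∑ i, (Q k i : L2Tensor τ →L[ℂ] L2Tensor τ) (V i),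
        ∑ j, (Q k j : L2Tensor τ →L[ℂ] L2Tensor τ) (V j)⟫_ℂ := by
    simp_rw [hentry, inner_add_right, Finset.sum_add_distrib]
    congr 1
    · refine Finset.sum_congr rfl fun i _ => ?_
      rw [Finset.sum_eq_single i]
      · rw [if_pos rfl]
      · intro j _ hj; rw [if_neg hj.symm, inner_zero_right]
      · simp
    · simp_rw [inner_sum, sum_inner]
      simp_rw [ContinuousLinearMap.star_eq_adjoint, ContinuousLinearMap.adjoint_inner_right]
      calc _ = ∑ i, ∑ k, ∑ j, ⟪(Q k i : L2Tensor τ →L[ℂ] L2Tensor τ) (V i),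
            (Q k j : L2Tensor τ →L[ℂ] L2Tensor τ) (V j)⟫_ℂ :=
          Finset.sum_congr rfl fun i _ => Finset.sum_comm
        _ = ∑ k, ∑ i, ∑ j, ⟪(Q k i : L2Tensor τ →L[ℂ] L2Tensor τ) (V i),
            (Q k j : L2Tensor τ →L[ℂ] L2Tensor τ) (V j)⟫_ℂ := Finset.sum_comm
        _ = _ := Finset.sum_congr rfl fun k _ => Finset.sum_comm
  have hre (x : L2Tensor τ) : (⟪x, x⟫_ℂ).re = ‖x‖ ^ 2 := inner_self_eq_norm_sq (𝕜 := ℂ) x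
  rw [hsum, Complex.add_re, Complex.re_sum, Complex.re_sum]
  simp_rw [hre]
  exact le_add_of_nonneg_right (Finset.sum_nonneg fun k _ => sq_nonneg _)

/-- The operator `(pᵢ) ↦ ∑ᵢ ∂ᵢ*(pᵢ ⊗ 1)` is bounded below by `1` under `CD(1, ∞)`. -/
theorem CurvatureDimension.sum_norm_sq_le_norm_sq_sum {h : LipschitzConjugateVariables τ X}
    (hCD : CurvatureDimension h 1) (hX : ∀ i, IsSelfAdjoint (X i))
    (hfree : AlgebraicallyFree X) (hd : DenseRange (polyL2 τ X)) (p : Fin n → NCPoly n)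
    (y : Fin n → L2 τ)
    (hy : ∀ i, HasAdjoint τ X i (tens τ (polyL2 τ X (p i)) (toL2 τ 1)) (y i)) :
    ∑ i, ‖polyL2 τ X (p i)‖ ^ 2 ≤ ‖∑ i, y i‖ ^ 2 := by
  let V : Fin n → L2Tensor τ := fun i => tens τ (toL2 τ (star (evalPoly X (p i)))) (toL2 τ 1)
  have hV : ∀ i, ‖V i‖ = ‖polyL2 τ X (p i)‖ := fun i => by
    rw [norm_tens, norm_toL2_star, norm_one_L2, mul_one, polyL2_apply]
  -- The adjoints in `V` reverse the roles of `i` and `j`: the Gram matrix is the transpose of the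
  -- matrix of the form. The double sum is unaffected.
  have hgram : ∀ i j, ⟪y i, y j⟫_ℂ =
      ⟪V j, (jacobian h j i : L2Tensor τ →L[ℂ] L2Tensor τ) (V i)⟫_ℂ := by
    intro i j
    obtain ⟨z, hz, hzw⟩ := exists_hasAdjoint_poly_tens_one hX hfree hd h j (p j)
    obtain rfl : z = y j := hz.unique hd (hy j)
    obtain ⟨w, hw, hwa⟩ := hzw i
    rw [← (hy i).inner_graph hfree (h.closable i) hw, hwa]
    exact inner_tens_one_elemTensor _ _ _
  have h1 := hCD.sum_norm_sq_le V
  simp_rw [hV, ← hgram] at h1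
  refine h1.trans (le_of_eq ?_)
  rw [← inner_self_eq_norm_sq (𝕜 := ℂ), RCLike.re_eq_complex_re, sum_inner]
  simp_rw [inner_sum]
  rw [Finset.sum_comm]

end Conjugate

/-! ### Density of the divergences of the vectors `p ⊗ 1` -/

section Density

variable {H : Type*} [NormedAddCommGroup H] [InnerProductSpace ℂ H] [CompleteSpace H]
  {M : VonNeumannAlgebra H} {τ : TracialState M} {n : ℕ} {X : Fin n → M.toStarSubalgebra}

variable (τ X) in
/-- The scalars together with the vectors `∂ᵢ*(p ⊗ 1)`, for polynomials `p`. -/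
def divergenceSet : Set (L2 τ) :=
  {y | y = toL2 τ 1 ∨ ∃ i p, HasAdjoint τ X i (tens τ (polyL2 τ X p) (toL2 τ 1)) y}

variable (τ X) in
/-- The orthogonal complement of the scalars and of the vectors `∂ᵢ*(p ⊗ 1)`. -/
abbrev divergenceOrth : Submodule ℂ (L2 τ) := (Submodule.span ℂ (divergenceSet τ X))ᗮ

theorem mem_divergenceOrth_iff {x : L2 τ} :
    x ∈ divergenceOrth τ X ↔ ∀ y ∈ divergenceSet τ X, ⟪y, x⟫_ℂ = 0 := by
  rw [divergenceOrth, Submodule.mem_orthogonal]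
  refine ⟨fun h y hy => h y (Submodule.subset_span hy), fun h y hy => ?_⟩
  induction hy using Submodule.span_induction with
  | mem y hy => exact h y hy
  | zero => exact inner_zero_left _
  | add y z _ _ hy hz => rw [inner_add_left, hy, hz, add_zero]
  | smul c y _ hy => rw [inner_smul_left, hy, mul_zero]

theorem inner_one_of_mem_divergenceOrth {x : L2 τ} (hx : x ∈ divergenceOrth τ X) :
    ⟪toL2 τ 1, x⟫_ℂ = 0 := mem_divergenceOrth_iff.1 hx _ (Or.inl rfl)

theorem inner_of_mem_divergenceOrth {x y : L2 τ} (hx : x ∈ divergenceOrth τ X) {i : Fin n}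
    {p : NCPoly n} (hy : HasAdjoint τ X i (tens τ (polyL2 τ X p) (toL2 τ 1)) y) :
    ⟪y, x⟫_ℂ = 0 := mem_divergenceOrth_iff.1 hx _ (Or.inr ⟨i, p, hy⟩)

theorem inner_X_mul_left (hX : ∀ i, IsSelfAdjoint (X i)) (k : Fin n) (x y : L2 τ) :
    ⟪leftMul τ (X k) x, y⟫_ℂ = ⟪x, leftMul τ (X k) y⟫_ℂ := by
  rw [inner_leftMul_left, (hX k).star_eq]

/-- Since `Xₖ ∂ᵢ*(p ⊗ 1)` is `∂ᵢ*(Xₖ p ⊗ 1)` plus a scalar, multiplication by `Xₖ` keeps a vector of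
the complement orthogonal to every divergence. Only orthogonality to `1` may be lost; subtracting a
multiple of `1` restores it without affecting the divergences, which are centered. -/
theorem X_mul_sub_mem_divergenceOrth (hX : ∀ i, IsSelfAdjoint (X i)) {x : L2 τ}
    (hx : x ∈ divergenceOrth τ X) (k : Fin n) :
    leftMul τ (X k) x - ⟪toL2 τ 1, leftMul τ (X k) x⟫_ℂ • toL2 τ 1 ∈ divergenceOrth τ X := by
  rw [mem_divergenceOrth_iff]
  rintro y (rfl | ⟨i, p, hy⟩)
  · rw [inner_sub_right, inner_smul_right, inner_one_one, mul_one, sub_self]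
  · have h1 := hy.X_mul hX k
    rw [elemTensor_tens, rightMul_one_apply, sliceLeft_tens, ← evalPoly_ι X k, ← polyL2_mul,
      evalPoly_ι] at h1
    have h2 := inner_of_mem_divergenceOrth hx h1
    have h3 : ⟪(if i = k then ⟪toL2 τ 1, polyL2 τ X p⟫_ℂ • toL2 τ 1 else 0 : L2 τ), x⟫_ℂ = 0 := by
      split_ifs
      · rw [inner_smul_left, inner_one_of_mem_divergenceOrth hx, mul_zero]
      · exact inner_zero_left _
    rw [inner_sub_left, h3, sub_zero, inner_X_mul_left hX] at h2
    rw [inner_sub_right, inner_smul_right, h2, ← inner_conj_symm y, hy.inner_one_left, map_zero,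
      mul_zero, sub_zero]

/-! ### Commutators of the projection onto the complement -/

variable (τ X) in
/-- The orthogonal projection onto the complement of the divergences. -/
abbrev orthProj : L2 τ →L[ℂ] L2 τ := (divergenceOrth τ X).starProjection

theorem orthProj_mem (x : L2 τ) : orthProj τ X x ∈ divergenceOrth τ X :=
  Submodule.starProjection_apply_mem _ _

theorem orthProj_eq_self {x : L2 τ} (hx : x ∈ divergenceOrth τ X) : orthProj τ X x = x :=
  Submodule.starProjection_eq_self_iff.2 hx

theorem inner_orthProj_left (x y : L2 τ) :
    ⟪orthProj τ X x, y⟫_ℂ = ⟪x, orthProj τ X y⟫_ℂ :=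
  Submodule.inner_starProjection_left_eq_right _ x y

theorem orthProj_one : orthProj τ X (toL2 τ 1) = 0 :=
  ext_inner_right ℂ fun x => by
    rw [inner_orthProj_left, inner_one_of_mem_divergenceOrth (orthProj_mem x), inner_zero_left]

variable (τ X) in
/-- The projection `rₖ` of `Xₖ` onto the complement of the divergences. -/
def residue (k : Fin n) : L2 τ := orthProj τ X (toL2 τ (X k))

/-- By the previous invariance, `Xₖ P = P Xₖ P + ⟪rₖ, ·⟫ 1`. Taking adjoints gives `P Xₖ = P Xₖ P +
⟪1, ·⟫ rₖ`, and the difference is the commutator. -/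
theorem X_mul_orthProj (hX : ∀ i, IsSelfAdjoint (X i)) (k : Fin n) (x : L2 τ) :
    leftMul τ (X k) (orthProj τ X x) = orthProj τ X (leftMul τ (X k) x) +
      (⟪residue τ X k, x⟫_ℂ • toL2 τ 1 - ⟪toL2 τ 1, x⟫_ℂ • residue τ X k) := by
  have hXk : leftMul τ (X k) (toL2 τ 1) = toL2 τ (X k) := by rw [leftMul_toL2, mul_one]
  have hc (z : L2 τ) : ⟪toL2 τ 1, leftMul τ (X k) (orthProj τ X z)⟫_ℂ = ⟪residue τ X k, z⟫_ℂ := by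
    rw [← inner_X_mul_left hX, hXk, ← inner_orthProj_left, residue]
  refine ext_inner_left ℂ fun z => ?_
  have h1 := orthProj_eq_self (X_mul_sub_mem_divergenceOrth hX (orthProj_mem (X := X) x) k)
  rw [map_sub, map_smul, orthProj_one, smul_zero, sub_zero, hc] at h1
  have h2 := orthProj_eq_self (X_mul_sub_mem_divergenceOrth hX (orthProj_mem (X := X) z) k)
  rw [map_sub, map_smul, orthProj_one, smul_zero, sub_zero, hc] at h2
  have h3 : ⟪z, orthProj τ X (leftMul τ (X k) (orthProj τ X x))⟫_ℂ =
      ⟪z, orthProj τ X (leftMul τ (X k) x)⟫_ℂ - ⟪toL2 τ 1, x⟫_ℂ * ⟪z, residue τ X k⟫_ℂ := by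
    have h4 : ⟪z, orthProj τ X (leftMul τ (X k) (orthProj τ X x))⟫_ℂ =
        ⟪orthProj τ X (leftMul τ (X k) (orthProj τ X z)), x⟫_ℂ := by
      rw [inner_orthProj_left, inner_X_mul_left hX, inner_orthProj_left]
    rw [h4, h2, inner_sub_left, inner_smul_left, inner_conj_symm, inner_X_mul_left hX,
      inner_orthProj_left, mul_comm]
  rw [h1, inner_sub_right, inner_smul_right] at h3
  rw [inner_add_right, inner_sub_right, inner_smul_right, inner_smul_right]
  linear_combination h3

/-- The vector `c ⊗ r e - c r* ⊗ e`. -/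
def commTensor (c e : M.toStarSubalgebra) (r : L2 τ) : L2Tensor τ :=
  tens τ (toL2 τ c) (rightMul τ e r) - tens τ (leftMul τ c (starL2 τ r)) (toL2 τ e)

theorem inner_commTensor_X_mul (hX : ∀ i, IsSelfAdjoint (X i)) (c e : M.toStarSubalgebra)
    (r : L2 τ) (k : Fin n) (v : L2Tensor τ) :
    ⟪commTensor c e r, elemTensor τ (X k) 1 v⟫_ℂ = ⟪commTensor (X k * c) e r, v⟫_ℂ := by
  have h1 := inner_elemTensor_left τ (X k) 1 (commTensor c e r) v
  rw [star_one, (hX k).star_eq] at h1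
  rw [← h1, commTensor, map_sub, elemTensor_tens, elemTensor_tens, rightMul_one_apply,
    rightMul_one_apply, leftMul_toL2, ← leftMul_mul_apply, commTensor]

/-- The right side is the commutator of `X_mul_orthProj` applied to `b * d` and tested against `c`,
with `r` in place of `rₖ`. This identity dictates the shape of `commTensor`. -/
theorem inner_commTensor_one_tens (c d : M.toStarSubalgebra) (r : L2 τ) (b : M.toStarSubalgebra) :
    ⟪commTensor c (star d) r, tens τ (toL2 τ 1) (toL2 τ b)⟫_ℂ =
      ⟪toL2 τ c, toL2 τ 1⟫_ℂ * ⟪r, toL2 τ (b * d)⟫_ℂ -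
        ⟪toL2 τ 1, toL2 τ (b * d)⟫_ℂ * ⟪toL2 τ c, r⟫_ℂ := by
  have h1 : ⟪leftMul τ c (starL2 τ r), toL2 τ 1⟫_ℂ = ⟪toL2 τ c, r⟫_ℂ := by
    rw [inner_leftMul_left, leftMul_toL2, mul_one, inner_starL2_left, starL2_toL2, star_star]
  have h2 : ⟪toL2 τ (star d), toL2 τ b⟫_ℂ = ⟪toL2 τ 1, toL2 τ (b * d)⟫_ℂ := by
    rw [inner_toL2, inner_toL2, star_star, star_one, one_mul, τ.tracial']
  rw [commTensor, inner_sub_left, inner_tens, inner_tens, inner_rightMul_left, star_star,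
    rightMul_toL2, h1, h2, mul_comm ⟪toL2 τ c, r⟫_ℂ]

/-- The commutator of a polynomial with `orthProj` is computed by the free difference
quotients. -/
theorem inner_comm_orthProj (hX : ∀ i, IsSelfAdjoint (X i)) (p : NCPoly n)
    (c d : M.toStarSubalgebra) :
    ⟪toL2 τ c, leftMul τ (evalPoly X p) (orthProj τ X (toL2 τ d))⟫_ℂ =
      ⟪toL2 τ c, orthProj τ X (toL2 τ (evalPoly X p * d))⟫_ℂ +
        ∑ j, ⟪commTensor c (star d) (residue τ X j), polyDer τ X j p⟫_ℂ := by
  -- `c` must vary: the variable peeled off on the left is moved onto it, replacing `c` by `Xₖ c`.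
  induction p using NCPoly.induction_left generalizing c with
  | hone => simp only [map_one, leftMul_one_apply, one_mul, polyDer_one, inner_zero_right,
      Finset.sum_const_zero, add_zero]
  | hadd p q hp hq =>
    simp only [map_add, leftMul_add_apply, add_mul, inner_add_right, hp, hq,
      Finset.sum_add_distrib]
    ring
  | hsmul r p hp =>
    simp only [map_smul, leftMul_smul_apply, smul_mul_assoc, inner_smul_right, hp,
      ← Finset.mul_sum]
    ring
  | X_mul k p hp =>
    have h1 : ∑ j, ⟪commTensor c (star d) (residue τ X j),
        polyDer τ X j (FreeAlgebra.ι ℂ k * p)⟫_ℂ =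
        ∑ j, ⟪commTensor (X k * c) (star d) (residue τ X j), polyDer τ X j p⟫_ℂ +
        ⟪commTensor c (star d) (residue τ X k), tens τ (toL2 τ 1) (polyL2 τ X p)⟫_ℂ := by
      simp_rw [polyDer_X_mul, inner_add_right, inner_commTensor_X_mul hX, Finset.sum_add_distrib]
      congr 1
      rw [Finset.sum_eq_single k]
      · rw [if_pos rfl]
      · intro j _ hj; rw [if_neg hj, inner_zero_right]
      · simp
    have h2 := hp (X k * c)
    rw [← leftMul_toL2 τ (X k) c, inner_X_mul_left hX, inner_X_mul_left hX, X_mul_orthProj hX,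
      leftMul_toL2, ← mul_assoc] at h2
    rw [h1, polyL2_apply, inner_commTensor_one_tens, map_mul, evalPoly_ι, leftMul_mul_apply, h2,
      inner_add_right, inner_sub_right, inner_smul_right, inner_smul_right]
    ring

set_option maxHeartbeats 400000 in
/-- The adjoint of a noncommutative polynomial in self-adjoint variables, and its free difference
quotients. -/
theorem exists_star_poly (hX : ∀ i, IsSelfAdjoint (X i)) (p : NCPoly n) :
    ∃ p', evalPoly X p' = star (evalPoly X p) ∧ ∀ i (a b : M.toStarSubalgebra),
      ⟪tens τ (toL2 τ a) (toL2 τ b), polyDer τ X i p'⟫_ℂ =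
        ⟪polyDer τ X i p, tens τ (toL2 τ (star b)) (toL2 τ (star a))⟫_ℂ := by
  induction p using NCPoly.induction_left with
  | hone =>
    refine ⟨1, by rw [map_one, star_one], fun i a b => ?_⟩
    rw [polyDer_one, inner_zero_left, inner_zero_right]
  | hadd p q hp hq =>
    obtain ⟨p', hp1, hp2⟩ := hp
    obtain ⟨q', hq1, hq2⟩ := hq
    refine ⟨p' + q', by rw [map_add, map_add, star_add, hp1, hq1], fun i a b => ?_⟩
    rw [map_add, map_add, inner_add_left, inner_add_right, hp2, hq2]
  | hsmul c p hp =>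
    obtain ⟨p', hp1, hp2⟩ := hp
    refine ⟨star c • p', by rw [map_smul, map_smul, star_smul, hp1], fun i a b => ?_⟩
    rw [map_smul, map_smul, inner_smul_left, inner_smul_right, hp2]
    rfl
  | X_mul k p hp =>
    obtain ⟨p', hp1, hp2⟩ := hp
    refine ⟨p' * FreeAlgebra.ι ℂ k, by
      rw [map_mul, map_mul, star_mul, hp1, evalPoly_ι, (hX k).star_eq], fun i a b => ?_⟩
    have h1 := inner_elemTensor_left τ 1 (X k) (tens τ (toL2 τ a) (toL2 τ b)) (polyDer τ X i p')
    rw [star_one, (hX k).star_eq, elemTensor_tens, leftMul_one_apply, rightMul_toL2, hp2,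
      star_mul, (hX k).star_eq] at h1
    have h2 := inner_elemTensor_left τ (X k) 1 (polyDer τ X i p)
      (tens τ (toL2 τ (star b)) (toL2 τ (star a)))
    rw [star_one, (hX k).star_eq, elemTensor_tens, rightMul_one_apply, leftMul_toL2] at h2
    rw [polyDer_X_mul, polyDer_mul_X, inner_add_right, inner_add_left, ← h1, h2]
    congr 1
    split_ifs
    · rw [inner_tens, inner_tens, polyL2_apply, polyL2_apply, hp1, inner_toL2, inner_toL2,
        inner_toL2, inner_toL2, mul_one, star_one, one_mul, mul_comm, τ.tracial']
    · rw [inner_zero_left, inner_zero_right]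

/-- The difference quotients of `p*` are those of `p` with legs swapped and starred, and `1 ⊗ 1` is
fixed by that operation. So `ξᵢ*` represents the same functional as `ξᵢ`. -/
theorem starL2_conjVar (hX : ∀ i, IsSelfAdjoint (X i)) (hfree : AlgebraicallyFree X)
    (hd : DenseRange (polyL2 τ X)) (h : LipschitzConjugateVariables τ X) (i : Fin n) :
    starL2 τ (conjVar τ X i (h.exists_conj i)) = conjVar τ X i (h.exists_conj i) := by
  have hξ := hasAdjoint_oneTensor hfree hd h i
  refine HasAdjoint.unique hd (fun p => ?_) hξ
  obtain ⟨p', hp1, hp2⟩ := exists_star_poly (τ := τ) hX p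
  have h1 := hp2 i 1 1
  rw [star_one, ← oneTensor_eq, hξ p', polyL2_apply, hp1] at h1
  rw [inner_starL2_left, polyL2_apply, starL2_toL2, ← inner_conj_symm,
    ← inner_conj_symm (toL2 τ _), h1]

/-- The residues are only known to be in `L²(M)`, so each of the two tensors has one leg there and
one polynomial leg; this is why `Dom ∂ⱼ*` was enlarged to such tensors. -/
theorem exists_hasAdjoint_commTensor (hX : ∀ i, IsSelfAdjoint (X i))
    (hfree : AlgebraicallyFree X) (hd : DenseRange (polyL2 τ X))
    (h : LipschitzConjugateVariables τ X) (c e : NCPoly n) (r : L2 τ) (j : Fin n) :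
    ∃ y, HasAdjoint τ X j (commTensor (evalPoly X c) (evalPoly X e) r) y := by
  obtain ⟨y, hy⟩ := exists_hasAdjoint_poly_tens hX hfree hd h j (rightMul τ (evalPoly X e) r) c
  obtain ⟨z, hz⟩ := exists_hasAdjoint_tens_poly hX hfree hd h j
    (leftMul τ (evalPoly X c) (starL2 τ r)) e
  exact ⟨y - z, hy.sub hz⟩

/-- An identity known on polynomials passes to `ξᵢ`: the `commTensor`s lie in the adjoint domains,
and by density their divergences sum to `z`. Pairing that sum with `ξᵢ ∈ Dom ∂̄` replaces `∂ⱼ p` by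
`∂̄ⱼ ξᵢ`, the Jacobian entry applied to `1 ⊗ 1`. -/
theorem sum_inner_commTensor (hX : ∀ i, IsSelfAdjoint (X i))
    (hfree : AlgebraicallyFree X) (hd : DenseRange (polyL2 τ X))
    (h : LipschitzConjugateVariables τ X) (c e : NCPoly n) (r : Fin n → L2 τ) (z : L2 τ)
    (hz : ∀ p, ∑ j, ⟪commTensor (evalPoly X c) (evalPoly X e) (r j), polyDer τ X j p⟫_ℂ =
      ⟪z, polyL2 τ X p⟫_ℂ) (i : Fin n) :
    ∑ j, ⟪commTensor (evalPoly X c) (evalPoly X e) (r j),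
      (jacobian h i j : L2Tensor τ →L[ℂ] L2Tensor τ) (oneTensor τ)⟫_ℂ =
      ⟪z, conjVar τ X i (h.exists_conj i)⟫_ℂ := by
  choose y hy using fun j => exists_hasAdjoint_commTensor hX hfree hd h c e (r j) j
  have hyz : ∑ j, y j = z := Dense.eq_of_inner_left ℂ hd (by
    rintro _ ⟨p, rfl⟩
    rw [← hz, sum_inner]
    exact Finset.sum_congr rfl fun j _ => (hy j p).symm)
  rw [← hyz, sum_inner]
  exact Finset.sum_congr rfl fun j _ =>
    (hy j).inner_graph hfree (h.closable j) (conjVar_mem_graph h j i)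

theorem inner_conjVar_orthProj (hfree : AlgebraicallyFree X) (hd : DenseRange (polyL2 τ X))
    (h : LipschitzConjugateVariables τ X) (i : Fin n) (x : L2 τ) :
    ⟪conjVar τ X i (h.exists_conj i), orthProj τ X x⟫_ℂ = 0 := by
  refine inner_of_mem_divergenceOrth (orthProj_mem x) (i := i) (p := 1) ?_
  rw [polyL2_one]
  exact hasAdjoint_oneTensor hfree hd h i

/-- For `c = 1` the term `⟪1, P(p d)⟫` vanishes because `P 1 = 0`. The functional of `p` is then
represented by `z = (P e*)*`, and `⟪z, ξᵢ⟫ = ⟪ξᵢ*, P e*⟫ = 0`, as `ξᵢ* = ξᵢ` is itself a divergence.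
-/
theorem sum_inner_commTensor_one_left (hX : ∀ i, IsSelfAdjoint (X i))
    (hfree : AlgebraicallyFree X) (hd : DenseRange (polyL2 τ X))
    (h : LipschitzConjugateVariables τ X) (e : NCPoly n) (i : Fin n) :
    ∑ j, ⟪commTensor 1 (evalPoly X e) (residue τ X j),
      (jacobian h i j : L2Tensor τ →L[ℂ] L2Tensor τ) (oneTensor τ)⟫_ℂ = 0 := by
  have h1 := sum_inner_commTensor hX hfree hd h 1 e (residue τ X)
    (starL2 τ (orthProj τ X (toL2 τ (star (evalPoly X e))))) (fun p => by
      have h2 := inner_comm_orthProj (τ := τ) hX p 1 (star (evalPoly X e))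
      rw [star_star, ← inner_orthProj_left, orthProj_one, inner_zero_left, zero_add] at h2
      rw [map_one (evalPoly X), ← h2, inner_starL2_left, polyL2_apply, starL2_toL2,
        ← star_star (evalPoly X p), ← inner_leftMul_left, leftMul_toL2, mul_one, star_star]) i
  rw [map_one (evalPoly X)] at h1
  rw [h1, inner_starL2_left, starL2_conjVar hX hfree hd h, inner_conjVar_orthProj hfree hd h]

/-- For `d = 1` the other side of the commutator vanishes, again by `P 1 = 0`. Now `z = -P c`, which
is orthogonal to the divergence `ξᵢ`. -/
theorem sum_inner_commTensor_one_right (hX : ∀ i, IsSelfAdjoint (X i))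
    (hfree : AlgebraicallyFree X) (hd : DenseRange (polyL2 τ X))
    (h : LipschitzConjugateVariables τ X) (c : NCPoly n) (i : Fin n) :
    ∑ j, ⟪commTensor (evalPoly X c) 1 (residue τ X j),
      (jacobian h i j : L2Tensor τ →L[ℂ] L2Tensor τ) (oneTensor τ)⟫_ℂ = 0 := by
  have h1 := sum_inner_commTensor hX hfree hd h c 1 (residue τ X)
    (-orthProj τ X (toL2 τ (evalPoly X c))) (fun p => by
      have h2 := inner_comm_orthProj (τ := τ) hX p (evalPoly X c) 1
      rw [star_one, orthProj_one, map_zero, inner_zero_right, mul_one] at h2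
      rw [map_one (evalPoly X), inner_neg_left, inner_orthProj_left, polyL2_apply]
      exact (neg_eq_of_add_eq_zero_right h2.symm).symm) i
  rw [map_one (evalPoly X)] at h1
  rw [h1, inner_neg_left, ← inner_conj_symm, inner_conjVar_orthProj hfree hd h, map_zero, neg_zero]

/-- For `r ∈ M`, both `1 ⊗ r*` and `r ⊗ 1` are right multiples of `1 ⊗ 1`. These multiplications
commute with `T`, and their adjoints turn `c ⊗ e` into the two terms of `commTensor`. General `r`
follows by continuity. -/
theorem inner_tens_tensorOp_apply (T : (tensorOp τ).toStarSubalgebra) (c e : M.toStarSubalgebra)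
    (r : L2 τ) :
    ⟪tens τ (toL2 τ c) (toL2 τ e), (T : L2Tensor τ →L[ℂ] L2Tensor τ)
      (tens τ (toL2 τ 1) (starL2 τ r) - tens τ r (toL2 τ 1))⟫_ℂ =
      ⟪commTensor c e r, (T : L2Tensor τ →L[ℂ] L2Tensor τ) (oneTensor τ)⟫_ℂ := by
  have hs := continuous_starL2 τ
  induction r using (denseRange_toL2 τ).induction_on with
  | hp =>
    unfold commTensor
    exact isClosed_eq (by fun_prop) (by fun_prop)
  | ih m =>
    have h1 : tens τ (toL2 τ 1) (toL2 τ (star m)) = outerMul τ (star 1) (star m) (oneTensor τ) := by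
      rw [oneTensor_eq, outerMul_tens, leftMul_toL2, star_one, rightMul_one_apply, mul_one]
    have h2 : tens τ (toL2 τ m) (toL2 τ 1) =
        outerMul τ (star (star m)) (star 1) (oneTensor τ) := by
      rw [oneTensor_eq, outerMul_tens, rightMul_toL2, star_one, leftMul_one_apply, one_mul,
        star_star]
    have h3 (v : L2Tensor τ) := inner_outerMul_left τ 1 m (tens τ (toL2 τ c) (toL2 τ e)) v
    have h4 (v : L2Tensor τ) := inner_outerMul_left τ (star m) 1 (tens τ (toL2 τ c) (toL2 τ e)) v
    simp only [outerMul_tens, leftMul_toL2, rightMul_toL2, mul_one, one_mul] at h3 h4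
    rw [starL2_toL2, map_sub, h1, h2, tensorOp_outerMul, tensorOp_outerMul, inner_sub_right,
      ← h3, ← h4, ← inner_sub_left, commTensor, starL2_toL2, leftMul_toL2, rightMul_toL2]

/-- The two special commutator identities make each component of `W = J V` orthogonal to all `1 ⊗ x`
and `x ⊗ 1`. Since each `Vᵢ` is a difference of such tensors, `⟪V, J V⟫ = 0`, and `J ≥ 1` forces `V
= 0`. -/
theorem residue_eq_zero (hX : ∀ i, IsSelfAdjoint (X i)) (hfree : AlgebraicallyFree X)
    (hd : DenseRange (polyL2 τ X)) {h : LipschitzConjugateVariables τ X}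
    (hCD : CurvatureDimension h 1) (i : Fin n) : residue τ X i = 0 := by
  let V : Fin n → L2Tensor τ := fun j =>
    tens τ (toL2 τ 1) (starL2 τ (residue τ X j)) - tens τ (residue τ X j) (toL2 τ 1)
  let W : Fin n → L2Tensor τ := fun i =>
    ∑ j, (jacobian h i j : L2Tensor τ →L[ℂ] L2Tensor τ) (V j)
  have hW (i : Fin n) (c e : M.toStarSubalgebra) : ⟪tens τ (toL2 τ c) (toL2 τ e), W i⟫_ℂ =
      ∑ j, ⟪commTensor c e (residue τ X j),
        (jacobian h i j : L2Tensor τ →L[ℂ] L2Tensor τ) (oneTensor τ)⟫_ℂ := by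
    rw [inner_sum]
    exact Finset.sum_congr rfl fun j _ => inner_tens_tensorOp_apply _ c e _
  have hW1 (i : Fin n) (x : L2 τ) : ⟪tens τ (toL2 τ 1) x, W i⟫_ℂ = 0 := by
    induction x using hd.induction_on with
    | hp => exact isClosed_eq (by fun_prop) continuous_const
    | ih p => rw [polyL2_apply, hW, sum_inner_commTensor_one_left hX hfree hd]
  have hW2 (i : Fin n) (x : L2 τ) : ⟪tens τ x (toL2 τ 1), W i⟫_ℂ = 0 := by
    induction x using hd.induction_on with
    | hp => exact isClosed_eq (by fun_prop) continuous_const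
    | ih p => rw [polyL2_apply, hW, sum_inner_commTensor_one_right hX hfree hd]
  have hVW (i : Fin n) : ⟪V i, W i⟫_ℂ = 0 := by rw [inner_sub_left, hW1, hW2, sub_zero]
  have h1 := hCD.sum_norm_sq_le V
  simp_rw [← inner_sum] at h1
  rw [Finset.sum_eq_zero fun i _ => hVW i, Complex.zero_re] at h1
  have h2 : ‖V i‖ ^ 2 ≤ 0 :=
    (Finset.single_le_sum (fun j _ => sq_nonneg ‖V j‖) (Finset.mem_univ i)).trans h1
  have hV : V i = 0 := by simpa using le_antisymm h2 (sq_nonneg _)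
  -- As the residue is centered, the two terms of `V i` are orthogonal, and this pairing isolates
  -- `-‖rᵢ‖²`.
  have h3 : ⟪tens τ (residue τ X i) (toL2 τ 1), V i⟫_ℂ = 0 := by rw [hV, inner_zero_right]
  have h4 : ⟪residue τ X i, toL2 τ 1⟫_ℂ = 0 := by
    rw [← inner_conj_symm, residue, inner_one_of_mem_divergenceOrth (orthProj_mem _), map_zero]
  rw [inner_sub_right, inner_tens, inner_tens, h4, zero_mul, inner_one_one, mul_one, zero_sub,
    neg_eq_zero, inner_self_eq_zero] at h3
  exact h3

/-- The scalars and the vectors `∂ᵢ*(p ⊗ 1)` span a dense subspace of `L²(M)`. -/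
theorem divergenceOrth_eq_bot (hX : ∀ i, IsSelfAdjoint (X i)) (hfree : AlgebraicallyFree X)
    (hd : DenseRange (polyL2 τ X)) {h : LipschitzConjugateVariables τ X}
    (hCD : CurvatureDimension h 1) : divergenceOrth τ X = ⊥ := by
  have h1 (p : NCPoly n) : orthProj τ X (polyL2 τ X p) = 0 := by
    induction p using NCPoly.induction_left with
    | hone => rw [polyL2_one, orthProj_one]
    | hadd p q hp hq => rw [map_add, map_add, hp, hq, add_zero]
    | hsmul c p hp => rw [map_smul, map_smul, hp, smul_zero]
    | X_mul k p hp =>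
      -- With zero residues `P` commutes with each `Xₖ`, so the vanishing of `P 1` propagates to all
      -- polynomials.
      have := X_mul_orthProj hX k (polyL2 τ X p)
      rw [residue_eq_zero hX hfree hd hCD, inner_zero_left, zero_smul, smul_zero, sub_zero,
        add_zero, hp, map_zero] at this
      rw [polyL2_mul, evalPoly_ι, ← this]
  rw [Submodule.eq_bot_iff]
  intro x hx
  rw [← orthProj_eq_self hx]
  exact hd.induction_on (p := fun x => orthProj τ X x = 0) x
    (isClosed_eq (orthProj τ X).continuous continuous_const) h1

end Density

/-! ### Minimizers of quadratic forms -/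

section Minimizer

variable {E F : Type*} [NormedAddCommGroup E] [InnerProductSpace ℂ E]
  [NormedAddCommGroup F] [InnerProductSpace ℂ F]

theorem norm_add_ofReal_smul_sq (x y : F) (r : ℝ) :
    ‖x + (r : ℂ) • y‖ ^ 2 = ‖x‖ ^ 2 + 2 * r * (⟪x, y⟫_ℂ).re + r ^ 2 * ‖y‖ ^ 2 := by
  rw [norm_add_sq (𝕜 := ℂ), inner_smul_right, norm_smul, mul_pow, Complex.norm_real,
    Real.norm_eq_abs, sq_abs, RCLike.re_eq_complex_re, Complex.re_ofReal_mul]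
  ring

/-- The difference of the two sides is a nonnegative quadratic polynomial in `r` with zero constant
term, so its linear coefficient vanishes; `discrim_le_zero` reads this as `b² ≤ 0`. -/
theorem re_inner_apply_eq_of_norm_sq_le {T : E →ₗ.[ℂ] F} {f g : T.domain}
    (hle : ∀ r : ℝ, ‖(f : E) + (r : ℂ) • (g : E)‖ ^ 2 ≤ ‖T f + (r : ℂ) • T g‖ ^ 2)
    (heq : ‖(f : E)‖ ^ 2 = ‖T f‖ ^ 2) : (⟪T f, T g⟫_ℂ).re = (⟪(f : E), (g : E)⟫_ℂ).re := by
  have h := discrim_le_zero (a := ‖T g‖ ^ 2 - ‖(g : E)‖ ^ 2)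
    (b := 2 * ((⟪T f, T g⟫_ℂ).re - (⟪(f : E), (g : E)⟫_ℂ).re)) (c := 0) fun r => by
      have := hle r
      rw [norm_add_ofReal_smul_sq, norm_add_ofReal_smul_sq, heq] at this
      linarith
  rw [discrim, mul_zero, sub_zero] at h
  have := pow_eq_zero_iff (two_ne_zero) |>.1 (le_antisymm h (sq_nonneg _))
  linarith

/-- Replacing `g` by `I • g` recovers the imaginary part. -/
theorem inner_apply_eq_of_norm_sq_le {T : E →ₗ.[ℂ] F} {f g : T.domain}
    (hle : ∀ c : ℂ, ‖(f : E) + c • (g : E)‖ ^ 2 ≤ ‖T f + c • T g‖ ^ 2)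
    (heq : ‖(f : E)‖ ^ 2 = ‖T f‖ ^ 2) : ⟪T f, T g⟫_ℂ = ⟪(f : E), (g : E)⟫_ℂ := by
  have h1 := re_inner_apply_eq_of_norm_sq_le (fun r => hle r) heq
  have h2 := re_inner_apply_eq_of_norm_sq_le (g := Complex.I • g) (fun r => by
    have := hle (r * Complex.I)
    rwa [mul_smul, mul_smul, ← T.map_smul, ← Submodule.coe_smul] at this) heq
  rw [T.map_smul, Submodule.coe_smul, inner_smul_right, inner_smul_right, Complex.I_mul_re,
    Complex.I_mul_re, neg_inj] at h2
  exact Complex.ext h1 h2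

theorem adjoint_comp_self_apply_eq_self [CompleteSpace E] {T : E →ₗ.[ℂ] F}
    (hd : Dense (T.domain : Set E)) {f : T.domain} (h : ∀ g : T.domain, ⟪T f, T g⟫_ℂ = ⟪(f : E), (g : E)⟫_ℂ) :
    ∃ hf : (f : E) ∈ (compPMap T† T).domain, compPMap T† T ⟨f, hf⟩ = f := by
  have hmem : T f ∈ T†.domain :=
    LinearPMap.mem_adjoint_domain_of_exists _ ⟨f, fun g => (h g).symm⟩
  refine ⟨mem_compPMap_domain.2 ⟨f.2, hmem⟩, ?_⟩
  rw [compPMap_apply f.2 hmem]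
  exact LinearPMap.adjoint_apply_eq hd _ fun g => (h g).symm

end Minimizer

section Poincare

variable {H : Type*} [NormedAddCommGroup H] [InnerProductSpace ℂ H] [CompleteSpace H]
  {M : VonNeumannAlgebra H} {τ : TracialState M} {n : ℕ} {X : Fin n → M.toStarSubalgebra}

/-! ### The closed gradient -/

theorem apply_mem_dqBar_graph (Y : (gradBar τ X).domain) (i : Fin n) :
    ((Y : L2 τ), gradBar τ X Y i) ∈ (dqBar τ X i).graph := by
  rw [gradBar_apply]
  exact (dqBar τ X i).mem_graph ⟨(Y : L2 τ), _⟩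

theorem mem_gradBar_graph_iff {x : L2 τ} {w : PiLp 2 fun _ : Fin n => L2Tensor τ} :
    (x, w) ∈ (gradBar τ X).graph ↔ ∀ i, (x, w i) ∈ (dqBar τ X i).graph := by
  constructor
  · intro hx i
    obtain ⟨Y, rfl, rfl⟩ := ((gradBar τ X).mem_graph_iff).1 hx
    exact apply_mem_dqBar_graph Y i
  · intro hx
    have hmem : x ∈ (gradBar τ X).domain :=
      (Submodule.mem_iInf _).2 fun i => LinearPMap.mem_domain_of_mem_graph (hx i)
    refine ((gradBar τ X).mem_graph_iff).2 ⟨⟨x, hmem⟩, rfl, ?_⟩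
    ext i
    exact (dqBar τ X i).mem_graph_snd_inj (apply_mem_dqBar_graph ⟨x, hmem⟩ i) (hx i) rfl

theorem isClosed_gradBar (hfree : AlgebraicallyFree X) (h : LipschitzConjugateVariables τ X) :
    (gradBar τ X).IsClosed := by
  have : ((gradBar τ X).graph : Set (L2 τ × PiLp 2 fun _ : Fin n => L2Tensor τ)) =
      ⋂ i, (fun z : L2 τ × PiLp 2 (fun _ : Fin n => L2Tensor τ) => (z.1, z.2 i)) ⁻¹'
        ((dqBar τ X i).graph : Set (L2 τ × L2Tensor τ)) := by
    ext ⟨x, w⟩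
    simp only [SetLike.mem_coe, mem_gradBar_graph_iff, Set.mem_iInter, Set.mem_preimage]
  change IsClosed ((gradBar τ X).graph : Set (L2 τ × PiLp 2 fun _ : Fin n => L2Tensor τ))
  rw [this]
  exact isClosed_iInter fun i =>
    (isClosed_dqBar_graph hfree (h.closable i)).preimage (by fun_prop)

theorem polyL2_mem_gradBar_graph (hfree : AlgebraicallyFree X)
    (h : LipschitzConjugateVariables τ X) (p : NCPoly n) :
    (polyL2 τ X p, WithLp.toLp 2 fun i => polyDer τ X i p) ∈ (gradBar τ X).graph :=
  mem_gradBar_graph_iff.2 fun i => polyL2_mem_graph hfree (h.closable i) p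

theorem dense_gradBar_domain (hfree : AlgebraicallyFree X) (hd : DenseRange (polyL2 τ X))
    (h : LipschitzConjugateVariables τ X) : Dense ((gradBar τ X).domain : Set (L2 τ)) := by
  refine hd.mono ?_
  rintro _ ⟨p, rfl⟩
  exact LinearPMap.mem_domain_of_mem_graph (polyL2_mem_gradBar_graph hfree h p)

theorem exists_one_mem_gradBar (hfree : AlgebraicallyFree X)
    (h : LipschitzConjugateVariables τ X) :
    ∃ e : (gradBar τ X).domain, (e : L2 τ) = toL2 τ 1 ∧ gradBar τ X e = 0 := by
  refine ((gradBar τ X).mem_graph_iff (x := (toL2 τ 1, 0))).1 ?_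
  exact mem_gradBar_graph_iff.2 fun i => one_mem_graph hfree (h.closable i)

theorem energy_eq_norm_sq (Y : (gradBar τ X).domain) : energy τ X Y = ‖gradBar τ X Y‖ ^ 2 :=
  (PiLp.norm_sq_eq_of_L2 _ _).symm

/-! ### The Poincaré inequality -/

theorem exists_divergence_of_mem_span {z : L2 τ}
    (hz : z ∈ Submodule.span ℂ (divergenceSet τ X)) :
    ∃ (c : ℂ) (p : Fin n → NCPoly n) (y : Fin n → L2 τ),
      (∀ i, HasAdjoint τ X i (tens τ (polyL2 τ X (p i)) (toL2 τ 1)) (y i)) ∧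
      z = c • toL2 τ 1 + ∑ i, y i := by
  have h0 (i : Fin n) : HasAdjoint τ X i (tens τ (polyL2 τ X 0) (toL2 τ 1)) 0 := fun q => by
    rw [map_zero, map_zero, zero_apply, inner_zero_left, inner_zero_left]
  induction hz using Submodule.span_induction with
  | mem z hz =>
    obtain rfl | ⟨i, p, hp⟩ := hz
    · exact ⟨1, 0, 0, h0, by simp⟩
    · refine ⟨0, Pi.single i p, Pi.single i z, fun j => ?_, ?_⟩
      · by_cases hj : j = i
        · subst hj; rwa [Pi.single_eq_same, Pi.single_eq_same]
        · rw [Pi.single_eq_of_ne hj, Pi.single_eq_of_ne hj]; exact h0 j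
      · rw [Finset.sum_pi_single', if_pos (Finset.mem_univ i), zero_smul, zero_add]
  | zero => exact ⟨0, 0, 0, h0, by simp⟩
  | add z z' _ _ h1 h2 =>
    obtain ⟨c, p, y, hy, rfl⟩ := h1
    obtain ⟨c', p', y', hy', rfl⟩ := h2
    refine ⟨c + c', p + p', y + y', fun i => ?_, ?_⟩
    · rw [Pi.add_apply, Pi.add_apply, map_add, map_add, add_apply]
      exact (hy i).add (hy' i)
    · simp only [Pi.add_apply, Finset.sum_add_distrib, add_smul]
      abel
  | smul a z _ h1 =>
    obtain ⟨c, p, y, hy, rfl⟩ := h1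
    refine ⟨a * c, a • p, a • y, fun i => ?_, ?_⟩
    · rw [Pi.smul_apply, Pi.smul_apply, map_smul, map_smul, smul_apply]
      exact (hy i).smul a
    · simp only [Pi.smul_apply, ← Finset.smul_sum, smul_add, mul_smul]

/-- The scalar part of `z` drops out of the pairing because `Y` is centered, and can only increase
`‖z‖` because divergences are centered too. What remains is Cauchy–Schwarz for `∑ ⟪pᵢ ⊗ 1, ∂̄ᵢ Y⟫`
and the lower bound on `‖∑ yᵢ‖`. -/
theorem norm_inner_le_of_mem_span (hX : ∀ i, IsSelfAdjoint (X i)) (hfree : AlgebraicallyFree X)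
    (hd : DenseRange (polyL2 τ X)) {h : LipschitzConjugateVariables τ X}
    (hCD : CurvatureDimension h 1) {z : L2 τ}
    (hz : z ∈ Submodule.span ℂ (divergenceSet τ X)) (Y : (gradBar τ X).domain)
    (hY : Centered τ (Y : L2 τ)) : ‖⟪z, (Y : L2 τ)⟫_ℂ‖ ≤ ‖z‖ * ‖gradBar τ X Y‖ := by
  obtain ⟨c, p, y, hy, rfl⟩ := exists_divergence_of_mem_span hz
  have h1 : ⟪c • toL2 τ 1 + ∑ i, y i, (Y : L2 τ)⟫_ℂ =
      ∑ i, ⟪tens τ (polyL2 τ X (p i)) (toL2 τ 1), gradBar τ X Y i⟫_ℂ := by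
    have hY' : ⟪toL2 τ 1, (Y : L2 τ)⟫_ℂ = 0 := hY
    rw [inner_add_left, inner_smul_left, hY', mul_zero, zero_add, sum_inner]
    exact Finset.sum_congr rfl fun i _ =>
      ((hy i).inner_graph hfree (h.closable i) (apply_mem_dqBar_graph Y i)).symm
  have h2 : ‖∑ i, y i‖ ^ 2 ≤ ‖c • toL2 τ 1 + ∑ i, y i‖ ^ 2 := by
    have h3 : ⟪c • toL2 τ 1, ∑ i, y i⟫_ℂ = 0 := by
      rw [inner_smul_left, inner_sum, Finset.sum_eq_zero fun i _ => (hy i).inner_one_left, mul_zero]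
    rw [norm_add_sq (𝕜 := ℂ), h3, map_zero, mul_zero, add_zero]
    exact le_add_of_nonneg_left (sq_nonneg _)
  have h4 := (hCD.sum_norm_sq_le_norm_sq_sum hX hfree hd p y hy).trans h2
  rw [h1]
  refine (norm_sum_le _ _).trans ?_
  calc ∑ i, ‖⟪tens τ (polyL2 τ X (p i)) (toL2 τ 1), gradBar τ X Y i⟫_ℂ‖
      ≤ ∑ i, ‖polyL2 τ X (p i)‖ * ‖gradBar τ X Y i‖ := Finset.sum_le_sum fun i _ => by
        have := norm_inner_le_norm (𝕜 := ℂ) (tens τ (polyL2 τ X (p i)) (toL2 τ 1))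
          (gradBar τ X Y i)
        rwa [norm_tens, norm_one_L2, mul_one] at this
    _ ≤ √(∑ i, ‖polyL2 τ X (p i)‖ ^ 2) * √(∑ i, ‖gradBar τ X Y i‖ ^ 2) :=
        Real.sum_mul_le_sqrt_mul_sqrt _ _ _
    _ ≤ _ := by
        rw [← PiLp.norm_sq_eq_of_L2, Real.sqrt_sq (norm_nonneg _)]
        exact mul_le_mul_of_nonneg_right ((Real.sqrt_le_left (norm_nonneg _)).2 h4) (norm_nonneg _)

/-- The Poincaré inequality. -/
theorem norm_le_norm_gradBar (hX : ∀ i, IsSelfAdjoint (X i)) (hfree : AlgebraicallyFree X)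
    (hd : DenseRange (polyL2 τ X)) {h : LipschitzConjugateVariables τ X}
    (hCD : CurvatureDimension h 1) (Y : (gradBar τ X).domain) (hY : Centered τ (Y : L2 τ)) :
    ‖(Y : L2 τ)‖ ≤ ‖gradBar τ X Y‖ := by
  have hdense : Dense (Submodule.span ℂ (divergenceSet τ X) : Set (L2 τ)) := by
    rw [Submodule.dense_iff_topologicalClosure_eq_top, Submodule.topologicalClosure_eq_top_iff]
    exact divergenceOrth_eq_bot hX hfree hd hCD
  have h1 : ∀ z : L2 τ, ‖⟪z, (Y : L2 τ)⟫_ℂ‖ ≤ ‖z‖ * ‖gradBar τ X Y‖ := fun z =>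
    closure_minimal (t := {z | ‖⟪z, (Y : L2 τ)⟫_ℂ‖ ≤ ‖z‖ * ‖gradBar τ X Y‖})
      (fun z hz => norm_inner_le_of_mem_span hX hfree hd hCD hz Y hY)
      (isClosed_le (by fun_prop) (by fun_prop)) (hdense z)
  have h2 := h1 Y
  rw [inner_self_eq_norm_sq_to_K, norm_pow, RCLike.norm_ofReal, abs_norm, sq] at h2
  obtain h3 | h3 := (norm_nonneg (Y : L2 τ)).eq_or_lt
  · rw [← h3]; exact norm_nonneg _
  · exact le_of_mul_le_mul_left h2 h3

/-- Equality in the Poincaré inequality. -/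
theorem inner_gradBar_eq_of_norm_eq (hX : ∀ i, IsSelfAdjoint (X i)) (hfree : AlgebraicallyFree X)
    (hd : DenseRange (polyL2 τ X)) {h : LipschitzConjugateVariables τ X}
    (hCD : CurvatureDimension h 1) (f : (gradBar τ X).domain) (hf : Centered τ (f : L2 τ))
    (heq : ‖(f : L2 τ)‖ ^ 2 = ‖gradBar τ X f‖ ^ 2) (g : (gradBar τ X).domain) :
    ⟪gradBar τ X f, gradBar τ X g⟫_ℂ = ⟪(f : L2 τ), (g : L2 τ)⟫_ℂ := by
  obtain ⟨e, he1, he2⟩ := exists_one_mem_gradBar hfree h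
  have hf' : ⟪toL2 τ 1, (f : L2 τ)⟫_ℂ = 0 := hf
  -- The Poincaré inequality covers only centered variations. Removing the mean of `g` changes
  -- neither inner product: `1` has zero gradient and is orthogonal to `f`.
  let g₀ : (gradBar τ X).domain := g - ⟪toL2 τ 1, (g : L2 τ)⟫_ℂ • e
  have hg₀ : ⟪toL2 τ 1, (g₀ : L2 τ)⟫_ℂ = 0 := by
    rw [Submodule.coe_sub, Submodule.coe_smul, he1, inner_sub_right, inner_smul_right,
      inner_one_one, mul_one, sub_self]
  have h1 := inner_apply_eq_of_norm_sq_le (f := f) (g := g₀) (fun c => by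
    have hc : Centered τ ((f + c • g₀ : (gradBar τ X).domain) : L2 τ) := by
      change ⟪toL2 τ 1, ((f + c • g₀ : (gradBar τ X).domain) : L2 τ)⟫_ℂ = 0
      rw [Submodule.coe_add, Submodule.coe_smul, inner_add_right, inner_smul_right, hf', hg₀,
        mul_zero, add_zero]
    have := norm_le_norm_gradBar hX hfree hd hCD _ hc
    rw [LinearPMap.map_add, LinearPMap.map_smul] at this
    exact pow_le_pow_left₀ (norm_nonneg _) this 2) heq
  rw [LinearPMap.map_sub, LinearPMap.map_smul, he2, smul_zero, sub_zero, Submodule.coe_sub,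
    Submodule.coe_smul, he1, inner_sub_right, inner_smul_right, ← inner_conj_symm _ (toL2 τ 1),
    hf', map_zero, mul_zero, sub_zero] at h1
  exact h1

end Poincare
end FreeProb
end

/-! ### The main theorem -/

theorem mainTheorem6 {H : Type*} [NormedAddCommGroup H] [InnerProductSpace ℂ H] [CompleteSpace H]
    (M : VonNeumannAlgebra H) (τ : FreeProb.TracialState M)
    {n : ℕ} (X : Fin n → M.toStarSubalgebra)
    (hX_selfAdjoint : ∀ i, IsSelfAdjoint (X i))
    (hX_generates :
      M = FreeProb.generatedVN (Set.range fun i => (X i : H →L[ℂ] H)))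
    (hX_free : FreeProb.AlgebraicallyFree X)
    (hLip : FreeProb.LipschitzConjugateVariables τ X)
    (hCD : FreeProb.CurvatureDimension hLip 1) :
    (∀ S, FreeProb.IsPositiveSqrt S (FreeProb.laplacian τ X) →
      S.domain = (FreeProb.gradBar τ X).domain) ∧
    (∀ Y : (FreeProb.gradBar τ X).domain, FreeProb.Centered τ (Y : FreeProb.L2 τ) →
      ‖(Y : FreeProb.L2 τ)‖ ^ 2 ≤ FreeProb.energy τ X Y) ∧
    (∀ f : (FreeProb.gradBar τ X).domain, FreeProb.Centered τ (f : FreeProb.L2 τ) →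
      ‖(f : FreeProb.L2 τ)‖ ^ 2 = FreeProb.energy τ X f →
      ∃ hf : (f : FreeProb.L2 τ) ∈ (FreeProb.laplacian τ X).domain,
        FreeProb.laplacian τ X ⟨f, hf⟩ = f) := by
  have hd : DenseRange (FreeProb.polyL2 τ X) :=
    FreeProb.denseRange_toL2_evalPoly τ hX_selfAdjoint hX_generates
  have hdom := FreeProb.dense_gradBar_domain hX_free hd hLip
  refine ⟨fun S hS => hS.domain_eq (FreeProb.isClosed_gradBar hX_free hLip) hdom,
    fun Y hY => ?_, fun f hf heq => ?_⟩
  · rw [FreeProb.energy_eq_norm_sq]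
    exact pow_le_pow_left₀ (norm_nonneg _)
      (FreeProb.norm_le_norm_gradBar hX_selfAdjoint hX_free hd hCD Y hY) 2
  · rw [FreeProb.energy_eq_norm_sq] at heq
    exact FreeProb.adjoint_comp_self_apply_eq_self hdom
      (FreeProb.inner_gradBar_eq_of_norm_eq hX_selfAdjoint hX_free hd hCD f hf heq)
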